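/- **Setting.** A buyer with budget $B\ge 0$ faces $n$ sellers of divisible items; seller $i$ has a public utility $u_i>0$ and a private cost $c_i\ge 0$, and $\gamma_i=c_i/u_i$. A mechanism maps reported ratios $\gamma\in\mathbb R_{\ge0}^n$ to purchased fractions $g(\gamma)\in[0,1]^n$ and payments per utility $Q(\gamma)\in\mathbb R_{\ge 0}^n$ (seller $i$ is paid $u_iQ(\gamma)_i$); the buyer's utility is $\sum_i u_i g(\gamma)_i$. It is *truthful* if reporting $\gamma_i$ maximizes $u_iQ(\cdot,\gamma_{-i})_i-c_i\,g(\cdot,\gamma_{-i})_i$ for all $i$ and all $\gamma$; *individually rational* (IR) at $\gamma$ if $u_iQ(\gamma)_i-c_i g(\gamma)_i\ge0$ for all $i$; *budget-feasible* at $\gamma$ if $\sum_i u_iQ(\gamma)_i\le B$; *uniform* if for each $\gamma$ there is one function $f$ with $g(z,\gamma_{-i})_i=f(z)$ for all $i$ and $z\ge 0$. A randomized mechanism is a distribution over deterministic ones; it is *truthful-in-expectation* if its expected allocation and payment are truthful, and *strictly budget-feasible* if every deterministic mechanism in its support is budget-feasible at every $\gamma$. For a set $S$ of sellers let $U_p(S)=\sum_{i\in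 S,\ \gamma_i\le p}u_i$. **Rule $(t,p_1,p_2)$** ($0\le t<1$, $p_1\le p_2$): buy fraction $1$ if $\gamma\le p_1$, $t$ if $p_1<\gamma\le p_2$, $0$ if $\gamma>p_2$, with Myerson payment per utility $tp_2+(1-t)p_1$, $tp_2$, $0$ respectively (a fraction $t$ at price $p_2$, then $1-t$ at price $p_1$). The value $p_1=0^-$ means an empty first step. **Greedy** on $S$ with budget $b$ (knows all costs): start with $p=0$. While some seller of $S$ has ratio above $p$, choose among these ratios a $q$ maximizing $\frac{U_q(S)-U_p(S)}{m(p,q)}$, where $m(p,q)=(q-p)U_p(S)+q\,(U_q(S)-U_p(S))$; if $m(p,q)\le b$, replace $(p,b)$ by $(q,b-m(p,q))$, otherwise stop with the rule $(b/m(p,q),p,q)$. If no ratio above $p$ is left, the rule is $(0,p,p)$. **Random-Sampling-Greedy** with parameters $\epsilon_1,\delta_1,\eta,C$ and a fixed order of the sellers: buy the items of the set $T$ of the $C$ sellers of highest utility (all sellers if $n\le C$), paying $\epsilon_1B/C$ to each. Partition the other sellers uniformly at random into $X$ and $Y$. Let $f_X,f_Y$ be the rules of Greedy on $X$ and on $Y$,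 each with budget $(1-\delta_1)B/2$. Truncate: for $S\in\{X,Y\}$, if $U_{p_1}(S)<\frac{1}{\eta C}\sum_{i\in T}u_i$ for the $p_1$ of $f_S$, replace $p_1$ by $0^-$. In the given order apply the truncated $f_X$ to the sellers in $Y$ until $(1-\epsilon_1)B/2$ is spent on $Y$, and the truncated $f_Y$ to the sellers in $X$ until $(1-\epsilon_1)B/2$ is spent on $X$. When the remaining money does not cover a seller's payment, only the part of the purchase it covers is made (first at price $p_2$, then at price $p_1$). **Theorem.** For all $\epsilon,\beta,\kappa>0$ there are $\epsilon_1,\delta_1,\eta\in(0,\kappa)$, an integer $C>1/\kappa$ and $\rho>0$ such that the following holds for all $n$, all $u\in\mathbb R_{>0}^n$, all $B\ge0$ and all orders of the sellers. Random-Sampling-Greedy is a randomized mechanism that is truthful-in-expectation and strictly budget-feasible. If moreover $0\le c_i\le\rho B$ for all $i$ (small bidders) and $\gamma_i=c_i/u_i$, then: 1. every realization of it is individually rational at $\gamma$; 2. with probability at least $1-\beta$ its utility is at least $(1-\epsilon)$ times the utility of Greedy run on all sellers with budget $B$; 3. for every uniform, truthful and individually rational mechanism that is budget-feasible at $\gamma$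 (it may be chosen with knowledge of the costs; allocations and payments may be expected values of a randomized mechanism), its utility at $\gamma$ is at most that of Greedy, and the expected utility of Random-Sampling-Greedy is at least $(1-\epsilon)$ times its utility at $\gamma$. -/

import Mathlib

noncomputable section

namespace BudgetFeasible

/-! ### Mechanisms

There are `n` sellers; seller `i` has a public utility `u i > 0` and a private cost `c i`.
A profile `γ : Fin n → ℝ` lists the (nonnegative) cost-per-utility ratios `γ i = c i / u i`
that the sellers report. -/

/-- A mechanism, for known utilities and budget: `alloc γ i` is the fraction of item `i` that is
bought and `pay γ i` the payment *per unit of utility* to seller `i`, so that seller `i` receives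
`pay γ i * u i` in total. For a randomized mechanism these are the expected values. -/
structure Mechanism (n : ℕ) where
  alloc : (Fin n → ℝ) → Fin n → ℝ
  pay : (Fin n → ℝ) → Fin n → ℝ

namespace Mechanism

variable {n : ℕ}

/-- Fractions lie in `[0,1]` and payments are nonnegative. -/
def Valid (M : Mechanism n) : Prop :=
  ∀ γ : Fin n → ℝ, (∀ i, 0 ≤ γ i) → ∀ i,
    0 ≤ M.alloc γ i ∧ M.alloc γ i ≤ 1 ∧ 0 ≤ M.pay γ i

/-- Net profit of seller `i`, whose true ratio is `x`, when the reported profile is `γ`. -/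
def profit (M : Mechanism n) (u : Fin n → ℝ) (γ : Fin n → ℝ) (i : Fin n) (x : ℝ) : ℝ :=
  M.pay γ i * u i - M.alloc γ i * (x * u i)

/-- Reporting the true ratio maximizes each seller's net profit, whatever the others report. -/
def Truthful (M : Mechanism n) (u : Fin n → ℝ) : Prop :=
  ∀ γ : Fin n → ℝ, (∀ i, 0 ≤ γ i) → ∀ i, ∀ z : ℝ, 0 ≤ z →
    M.profit u (Function.update γ i z) i (γ i) ≤ M.profit u γ i (γ i)

/-- On the profile `γ`, no seller who reports truthfully makes a loss. -/
def IndividuallyRationalAt (M : Mechanism n) (u γ : Fin n → ℝ) : Prop :=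
  ∀ i, 0 ≤ M.profit u γ i (γ i)

/-- On the profile `γ`, the total payment is within the budget `B`. -/
def BudgetFeasibleAt (M : Mechanism n) (u : Fin n → ℝ) (B : ℝ) (γ : Fin n → ℝ) : Prop :=
  ∑ i, M.pay γ i * u i ≤ B

/-- All sellers face one and the same one-dimensional allocation function `f`. -/
def Uniform (M : Mechanism n) : Prop :=
  ∀ γ : Fin n → ℝ, (∀ i, 0 ≤ γ i) → ∃ f : ℝ → ℝ, ∀ i, ∀ z : ℝ, 0 ≤ z →
    M.alloc (Function.update γ i z) i = f z

/-- The buyer's total utility. -/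
def utility (M : Mechanism n) (u γ : Fin n → ℝ) : ℝ := ∑ i, M.alloc γ i * u i

end Mechanism

/-- A randomized mechanism is a distribution of deterministic mechanisms; here the randomness is a
seed from a finite type. -/
structure RandomizedMechanism (n : ℕ) where
  Seed : Type
  [fintypeSeed : Fintype Seed]
  law : PMF Seed
  run : Seed → Mechanism n

namespace RandomizedMechanism

attribute [instance] RandomizedMechanism.fintypeSeed

variable {n : ℕ}

/-- Expected allocations and expected payments. -/
def expected (R : RandomizedMechanism n) : Mechanism n where
  alloc γ i := ∑ ω, (R.law ω).toReal * (R.run ω).alloc γ i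
  pay γ i := ∑ ω, (R.law ω).toReal * (R.run ω).pay γ i

def TruthfulInExpectation (R : RandomizedMechanism n) (u : Fin n → ℝ) : Prop :=
  R.expected.Truthful u

/-- Every deterministic mechanism in the support obeys the budget on every profile of reports. -/
def StrictlyBudgetFeasible (R : RandomizedMechanism n) (u : Fin n → ℝ) (B : ℝ) : Prop :=
  ∀ ω ∈ R.law.support, ∀ γ : Fin n → ℝ, (∀ i, 0 ≤ γ i) → (R.run ω).BudgetFeasibleAt u B γ

/-- The probability that the realized deterministic mechanism satisfies `P`. -/
def prob (R : RandomizedMechanism n) (P : Mechanism n → Prop) : ℝ :=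
  (R.law.toOuterMeasure {ω | P (R.run ω)}).toReal

end RandomizedMechanism

/-! ### Allocation rules with at most two steps -/

/-- The allocation rule `(t, p₁, p₂)`: fraction `1` for ratios at most `p₁`, fraction `t` for
ratios in `(p₁, p₂]`, fraction `0` above `p₂`. A negative `p₁` means that the first step is empty.
Its Myerson payment per utility `γ * f γ + ∫ z in (γ,∞), f z` is
`t * p₂ + (1 - t) * p₁`, `t * p₂` and `0` on the three steps: a fraction `t` is bought at
price `p₂` per utility, and the remaining fraction `1 - t` at price `p₁`. -/
structure TwoPriceRule where
  t : ℝ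
  p₁ : ℝ
  p₂ : ℝ

def TwoPriceRule.alloc (f : TwoPriceRule) (γ : ℝ) : ℝ :=
  if γ ≤ f.p₁ then 1 else if γ ≤ f.p₂ then f.t else 0

section Greedy

variable {n : ℕ}

/-- Total utility of the sellers in `S` with ratio at most `p`. -/
def postedUtility (u γ : Fin n → ℝ) (S : Finset (Fin n)) (p : ℝ) : ℝ :=
  ∑ i ∈ S with γ i ≤ p, u i

/-- The distinct ratios above `p` among the sellers in `S`. -/
def ratiosAbove (γ : Fin n → ℝ) (S : Finset (Fin n)) (p : ℝ) : Finset ℝ :=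
  (S.image γ).filter (fun q => p < q)

/-- Additional payment when the allocation on `(p, q]` is raised from `0` to `1`, everything up
to `p` being bought already. -/
def marginalPayment (u γ : Fin n → ℝ) (S : Finset (Fin n)) (p q : ℝ) : ℝ :=
  (q - p) * postedUtility u γ S p + q * (postedUtility u γ S q - postedUtility u γ S p)

/-- Marginal utility per marginal payment of raising the allocation on `(p, q]`. -/
def marginalEfficiency (u γ : Fin n → ℝ) (S : Finset (Fin n)) (p q : ℝ) : ℝ :=
  (postedUtility u γ S q - postedUtility u γ S p) / marginalPayment u γ S p q

/-- A next ratio of largest marginal utility per marginal payment (ties are broken arbitrarily). -/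
def bestNext (u γ : Fin n → ℝ) (S : Finset (Fin n)) (p : ℝ) (h : (ratiosAbove γ S p).Nonempty) :
    ℝ :=
  (Finset.exists_max_image (ratiosAbove γ S p) (marginalEfficiency u γ S p) h).choose

theorem bestNext_mem (u γ : Fin n → ℝ) (S : Finset (Fin n)) (p : ℝ)
    (h : (ratiosAbove γ S p).Nonempty) : bestNext u γ S p h ∈ ratiosAbove γ S p :=
  (Finset.exists_max_image (ratiosAbove γ S p) (marginalEfficiency u γ S p) h).choose_spec.1

theorem card_ratiosAbove_lt (γ : Fin n → ℝ) (S : Finset (Fin n)) {p q : ℝ}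
    (h : q ∈ ratiosAbove γ S p) : (ratiosAbove γ S q).card < (ratiosAbove γ S p).card := by
  have hq := (Finset.mem_filter.1 h).2
  refine Finset.card_lt_card (Finset.ssubset_iff_of_subset ?_ |>.2 ⟨q, h, ?_⟩)
  · intro r hr
    obtain ⟨h1, h2⟩ := Finset.mem_filter.1 hr
    exact Finset.mem_filter.2 ⟨h1, hq.trans h2⟩
  · intro hr
    exact lt_irrefl _ (Finset.mem_filter.1 hr).2

/-- The main loop of Greedy on the sellers in `S`: all ratios up to `p` are bought fully, and the
budget `b` remains. If the remaining budget is exactly the marginal payment, the loop goes on with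
remaining budget `0`, so that `(p, q]` gets fraction `1` and everything above `q` gets
fraction `0`; hence always `t < 1`. -/
def greedyLoop (u γ : Fin n → ℝ) (S : Finset (Fin n)) (p b : ℝ) : TwoPriceRule :=
  if h : (ratiosAbove γ S p).Nonempty then
    if marginalPayment u γ S p (bestNext u γ S p h) ≤ b then
      greedyLoop u γ S (bestNext u γ S p h) (b - marginalPayment u γ S p (bestNext u γ S p h))
    else
      ⟨b / marginalPayment u γ S p (bestNext u γ S p h), p, bestNext u γ S p h⟩
  else ⟨0, p, p⟩
termination_by (ratiosAbove γ S p).card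
decreasing_by exact card_ratiosAbove_lt γ S (bestNext_mem u γ S p h)

/-- The allocation rule that the complete-information mechanism Greedy computes for the sellers
in `S` with ratios `γ` and budget `b`; ratio `0` is always allocated fully. -/
def greedy (u γ : Fin n → ℝ) (S : Finset (Fin n)) (b : ℝ) : TwoPriceRule :=
  greedyLoop u γ S 0 b

/-- The utility that Greedy attains on all sellers with budget `B`. -/
def greedyUtility (u γ : Fin n → ℝ) (B : ℝ) : ℝ :=
  ∑ i, (greedy u γ Finset.univ B).alloc (γ i) * u i

/-! ### Random-Sampling-Greedy -/

/-- The `C` sellers of highest utility (ties are broken by index); all sellers if `n ≤ C`. -/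
def topSellers (u : Fin n → ℝ) (C : ℕ) : Finset (Fin n) :=
  {i | Finset.card {j | u i < u j ∨ (u j = u i ∧ j < i)} < C}

/-- Truncation of a rule computed from the sample `S`: the step `[0, p₁]` is lowered to `t` when
the sampled sellers with ratio at most `p₁` have total utility below `U(T) / (η C)`, where `T` is
the set of the top `C` sellers. -/
def truncate (u γ : Fin n → ℝ) (η : ℝ) (C : ℕ) (S : Finset (Fin n)) (f : TwoPriceRule) :
    TwoPriceRule :=
  if postedUtility u γ S f.p₁ < (∑ i ∈ topSellers u C, u i) / (η * C) then ⟨f.t, -1, f.p₂⟩ else f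

/-- The part of a fraction `x` of an item of utility `v` that is bought at price `p` per utility
when only the amount `r` of money is left: all of it if affordable, else as much as `r` buys. -/
def affordable (x p v r : ℝ) : ℝ := if x * p * v ≤ r then x else r / (p * v)

/-- Fraction bought at price `p₂` from a seller with utility `v` and ratio `x`, if `r` is left. -/
def TwoPriceRule.soldAtP₂ (f : TwoPriceRule) (v x r : ℝ) : ℝ :=
  if x ≤ f.p₂ then affordable f.t f.p₂ v r else 0

/-- Fraction then bought at price `p₁`. -/
def TwoPriceRule.soldAtP₁ (f : TwoPriceRule) (v x r : ℝ) : ℝ :=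
  if x ≤ f.p₁ then affordable (1 - f.t) f.p₁ v (r - f.p₂ * v * f.soldAtP₂ v x r) else 0

/-- Fraction and payment per utility when the rule `f` is applied to a seller with utility `v` and
ratio `x` while the amount `r` is left. If `r` covers the payment, these are the values of `f`
and of its Myerson payment at `x`; otherwise only the part of the purchase that `r` covers is
made. -/
def TwoPriceRule.applyTo (f : TwoPriceRule) (v x r : ℝ) : ℝ × ℝ :=
  (f.soldAtP₂ v x r + f.soldAtP₁ v x r, f.p₂ * f.soldAtP₂ v x r + f.p₁ * f.soldAtP₁ v x r)

/-- Apply `f` one after the other to the sellers in the list until the amount `r` is spent; the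
result gives each listed seller's fraction and payment per utility. -/
def applySequentially (f : TwoPriceRule) (u γ : Fin n → ℝ) :
    ℝ → List (Fin n) → Fin n → ℝ × ℝ
  | _, [], _ => (0, 0)
  | r, j :: l, i =>
    if i = j then f.applyTo (u j) (γ j) r
    else applySequentially f u γ (r - (f.applyTo (u j) (γ j) r).2 * u j) l i

/-- Fraction and payment per utility of seller `i` in Random-Sampling-Greedy on the reports `γ`,
when the sellers outside the top set `T` are partitioned into `X = W \ T` and `Y = (T ∪ W)ᶜ`, and
sellers are processed in the order `σ 0, σ 1, …`. -/
def rsgOutcome (u : Fin n → ℝ) (B ε₁ δ₁ η : ℝ) (C : ℕ) (σ : Equiv.Perm (Fin n))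
    (W : Finset (Fin n)) (γ : Fin n → ℝ) (i : Fin n) : ℝ × ℝ :=
  let T := topSellers u C
  let X := W \ T
  let Y := (T ∪ W)ᶜ
  let fX := truncate u γ η C X (greedy u γ X ((1 - δ₁) * B / 2))
  let fY := truncate u γ η C Y (greedy u γ Y ((1 - δ₁) * B / 2))
  let inOrder := fun S : Finset (Fin n) => ((List.finRange n).map σ).filter (fun j => j ∈ S)
  if i ∈ T then (1, ε₁ * B / C / u i)
  else if i ∈ Y then applySequentially fX u γ ((1 - ε₁) * B / 2) (inOrder Y) i
  else applySequentially fY u γ ((1 - ε₁) * B / 2) (inOrder X) i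

/-- Random-Sampling-Greedy. A uniformly random set `W` of sellers puts each seller outside the top
set into `X` or `Y` by independent fair coins. -/
def randomSamplingGreedy (u : Fin n → ℝ) (B ε₁ δ₁ η : ℝ) (C : ℕ) (σ : Equiv.Perm (Fin n)) :
    RandomizedMechanism n where
  Seed := Finset (Fin n)
  law := PMF.uniformOfFintype (Finset (Fin n))
  run W :=
    { alloc := fun γ i => (rsgOutcome u B ε₁ δ₁ η C σ W γ i).1
      pay := fun γ i => (rsgOutcome u B ε₁ δ₁ η C σ W γ i).2 }

end Greedy

end BudgetFeasible

end

/-! For a threshold `q` let `U_q` be the utility of the sellers with ratio at most `q`. Buying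
everything up to `q` has cost and utility `(q * U_q, U_q)`. Greedy follows the upper concave hull of
these points until the budget runs out, so its value is certified by a line of some slope `l ≥ 0`
lying above all of them (`isSupportedRule_greedy`). A uniform truthful mechanism has a nonincreasing
allocation function, hence is a mixture of thresholds, and truthfulness with individual rationality
forces it to pay at least the mixed cost. The same line therefore bounds its utility by that of
Greedy (`sum_alloc_sub_pay_le`).

Incentives hold split by split. A top seller gets a fixed offer. Any other seller faces two posted
prices, and neither the prices nor the amounts depend on the seller's own report, because the rule
is learned from the other half (`isPostedPrice_rsgOutcome`).

For performance, every seller outside the top set `T` has utility at most `U(T) / C`. A maximal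
inequality then shows that with high probability the two halves have similar posted utilities at all
thresholds simultaneously, up to a relative error `d` and an additive multiple of `U(T) / C`
(`card_not_balanced_split_le`). On such a split, a slightly scaled copy of the global Greedy rule
fits the budget of one half, so Greedy on that half earns almost half of the value outside `T`
(`greedy_value_half_ge`). The rule it computes carries over to the other half, up to the truncation
threshold (`sum_sampleRule_ge`). For large `C` all additive losses are a small fraction of `U(T)`,
and `T` is bought in full (`utility_run_ge`). -/

namespace BudgetFeasible

variable {n : ℕ}

/-! ### Utility and cost of a single threshold. -/

section PostedUtility

variable {u γ : Fin n → ℝ} {S : Finset (Fin n)} {p q b : ℝ}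

theorem postedUtility_nonneg (hu : ∀ i, 0 ≤ u i) : 0 ≤ postedUtility u γ S p :=
  Finset.sum_nonneg fun i _ => hu i

theorem postedUtility_mono (hu : ∀ i, 0 ≤ u i) (h : p ≤ q) :
    postedUtility u γ S p ≤ postedUtility u γ S q := by
  refine Finset.sum_le_sum_of_subset_of_nonneg (fun i hi => ?_) fun i _ _ => hu i
  rw [Finset.mem_filter] at hi ⊢
  exact ⟨hi.1, hi.2.trans h⟩

theorem postedUtility_of_neg (hγ : ∀ i, 0 ≤ γ i) (hp : p < 0) : postedUtility u γ S p = 0 := by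
  unfold postedUtility
  rw [Finset.filter_false_of_mem, Finset.sum_empty]
  intro i _ h
  linarith [hγ i]

theorem postedUtility_eq_sum_ite :
    postedUtility u γ S p = ∑ i ∈ S, if γ i ≤ p then u i else 0 := by
  rw [postedUtility, Finset.sum_filter]

theorem thresholdCost_mono (hu : ∀ i, 0 ≤ u i) (hp : 0 ≤ p) (h : p ≤ q) :
    p * postedUtility u γ S p ≤ q * postedUtility u γ S q :=
  mul_le_mul h (postedUtility_mono hu h) (postedUtility_nonneg hu) (hp.trans h)

theorem marginalPayment_eq :
    marginalPayment u γ S p q = q * postedUtility u γ S q - p * postedUtility u γ S p := by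
  unfold marginalPayment
  ring

/-- A ratio above `p` belongs to some seller of positive utility. This makes every division by a
marginal payment in Greedy legitimate. -/
theorem marginalPayment_pos (hu : ∀ i, 0 < u i) (hp : 0 ≤ p) (hq : q ∈ ratiosAbove γ S p) :
    0 < marginalPayment u γ S p q := by
  obtain ⟨h1, h2⟩ := Finset.mem_filter.1 hq
  obtain ⟨i, hi, rfl⟩ := Finset.mem_image.1 h1
  have hpos : 0 < postedUtility u γ S (γ i) :=
    Finset.sum_pos (fun j _ => hu j) ⟨i, Finset.mem_filter.2 ⟨hi, le_rfl⟩⟩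
  have hmono := postedUtility_mono (γ := γ) (S := S) (fun i => (hu i).le) h2.le
  rw [marginalPayment_eq]
  nlinarith

/-- Between consecutive ratios the posted utility is constant. -/
theorem postedUtility_eq_or_exists_ratio (h : p ≤ q) :
    postedUtility u γ S q = postedUtility u γ S p ∨
      ∃ r ∈ ratiosAbove γ S p, r ≤ q ∧ postedUtility u γ S q = postedUtility u γ S r := by
  by_cases hne : ((ratiosAbove γ S p).filter (· ≤ q)).Nonempty
  · right
    have hmem := Finset.max'_mem _ hne
    obtain ⟨hr, hrq⟩ := Finset.mem_filter.1 hmem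
    refine ⟨_, hr, hrq, ?_⟩
    unfold postedUtility
    congr 1
    refine Finset.filter_congr fun i hi => ⟨fun hiq => ?_, fun hir => hir.trans hrq⟩
    rcases le_or_gt (γ i) p with hip | hip
    · exact hip.trans (Finset.mem_filter.1 hr).2.le
    · exact Finset.le_max' _ _ (Finset.mem_filter.2
        ⟨Finset.mem_filter.2 ⟨Finset.mem_image_of_mem _ hi, hip⟩, hiq⟩)
  · left
    unfold postedUtility
    congr 1
    refine Finset.filter_congr fun i hi => ⟨fun hiq => ?_, fun hip => hip.trans h⟩
    by_contra hip
    exact hne ⟨γ i, Finset.mem_filter.2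
      ⟨Finset.mem_filter.2 ⟨Finset.mem_image_of_mem _ hi, not_le.1 hip⟩, hiq⟩⟩

end PostedUtility

/-! ### Greedy follows the concave hull of the threshold points. -/

section GreedyRule

/-- Utility obtained from the sellers in `S` by a two-price rule. -/
noncomputable def TwoPriceRule.value (f : TwoPriceRule) (u γ : Fin n → ℝ) (S : Finset (Fin n)) :
    ℝ :=
  f.t * postedUtility u γ S f.p₂ + (1 - f.t) * postedUtility u γ S f.p₁

/-- Total Myerson payment of a two-price rule to the sellers in `S`. -/
noncomputable def TwoPriceRule.cost (f : TwoPriceRule) (u γ : Fin n → ℝ) (S : Finset (Fin n)) :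
    ℝ :=
  f.t * (f.p₂ * postedUtility u γ S f.p₂) + (1 - f.t) * (f.p₁ * postedUtility u γ S f.p₁)

/-- A two-price rule within budget whose value is certified by a supporting line of the points
`(q * U_q, U_q)`. -/
structure IsSupportedRule (u γ : Fin n → ℝ) (S : Finset (Fin n)) (b : ℝ) (f : TwoPriceRule) :
    Prop where
  t_nonneg : 0 ≤ f.t
  t_lt_one : f.t < 1
  p₁_nonneg : 0 ≤ f.p₁
  p₁_le_p₂ : f.p₁ ≤ f.p₂
  cost_le : f.cost u γ S ≤ b
  exists_slope : ∃ l : ℝ, 0 ≤ l ∧ ∀ q, 0 ≤ q →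
    postedUtility u γ S q - l * (q * postedUtility u γ S q) ≤ f.value u γ S - l * b

variable {u γ : Fin n → ℝ} {S : Finset (Fin n)} {p b : ℝ}

/-- If the slopes to the left of `p` dominate those to its right, then the segment from `p` to the
best next ratio spans a supporting line. -/
theorem exists_supporting_slope (hu : ∀ i, 0 < u i) (hp : 0 ≤ p)
    (hinv : ∀ q, 0 ≤ q → q ≤ p → ∀ r ∈ ratiosAbove γ S p,
      (postedUtility u γ S r - postedUtility u γ S p) *
          (p * postedUtility u γ S p - q * postedUtility u γ S q) ≤
        (postedUtility u γ S p - postedUtility u γ S q) * marginalPayment u γ S p r)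
    (h : (ratiosAbove γ S p).Nonempty) :
    ∃ l : ℝ, 0 ≤ l ∧
      (∀ q, 0 ≤ q → postedUtility u γ S q - l * (q * postedUtility u γ S q) ≤
        postedUtility u γ S p - l * (p * postedUtility u γ S p)) ∧
      postedUtility u γ S (bestNext u γ S p h) - postedUtility u γ S p =
        l * marginalPayment u γ S p (bestNext u γ S p h) := by
  have hu' : ∀ i, 0 ≤ u i := fun i => (hu i).le
  set r := bestNext u γ S p h with hr
  have hrm : r ∈ ratiosAbove γ S p := bestNext_mem u γ S p h
  have hbest : ∀ q ∈ ratiosAbove γ S p,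
      marginalEfficiency u γ S p q ≤ marginalEfficiency u γ S p r :=
    (Finset.exists_max_image (ratiosAbove γ S p) (marginalEfficiency u γ S p) h).choose_spec.2
  have hm := marginalPayment_pos hu hp hrm
  have hpr : p ≤ r := (Finset.mem_filter.1 hrm).2.le
  have heq : postedUtility u γ S r - postedUtility u γ S p =
      marginalEfficiency u γ S p r * marginalPayment u γ S p r := by
    rw [marginalEfficiency, div_mul_cancel₀ _ hm.ne']
  have hl : 0 ≤ marginalEfficiency u γ S p r :=
    div_nonneg (sub_nonneg.2 (postedUtility_mono hu' hpr)) hm.le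
  refine ⟨marginalEfficiency u γ S p r, hl, fun q hq => ?_, heq⟩
  rcases le_total q p with hqp | hqp
  · have h1 := hinv q hq hqp r hrm
    rw [heq] at h1
    have h2 : marginalEfficiency u γ S p r *
        (p * postedUtility u γ S p - q * postedUtility u γ S q) ≤
          postedUtility u γ S p - postedUtility u γ S q := by
      refine le_of_mul_le_mul_right ?_ hm
      linarith
    linarith
  -- To the right of `p` it suffices to test sellers' ratios: between them the utility is constant
  -- while the cost only grows.
  · rcases postedUtility_eq_or_exists_ratio (u := u) (γ := γ) (S := S) hqp with he | ⟨s, hs, hsq, he⟩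
    · have h1 := mul_le_mul_of_nonneg_left (thresholdCost_mono (γ := γ) (S := S) hu' hp hqp) hl
      linarith
    · have hsp : p ≤ s := (Finset.mem_filter.1 hs).2.le
      have h1 := mul_le_mul_of_nonneg_left
        (thresholdCost_mono (γ := γ) (S := S) hu' (hp.trans hsp) hsq) hl
      have h2 := hbest s hs
      rw [marginalEfficiency, div_le_iff₀ (marginalPayment_pos hu hp hs),
        marginalPayment_eq] at h2
      linarith

/-- The loop invariant `hinv` is concavity at `p`: slopes arriving at `p` are at least slopes
leaving it. It is cross-multiplied because a cost difference on the left may vanish. Since `p * U_p`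
has been spent already, `b + p * U_p` is the whole budget and stays constant along the loop. -/
theorem isSupportedRule_greedyLoop (hu : ∀ i, 0 < u i) (hp : 0 ≤ p) (hb : 0 ≤ b)
    (hinv : ∀ q, 0 ≤ q → q ≤ p → ∀ r ∈ ratiosAbove γ S p,
      (postedUtility u γ S r - postedUtility u γ S p) *
          (p * postedUtility u γ S p - q * postedUtility u γ S q) ≤
        (postedUtility u γ S p - postedUtility u γ S q) * marginalPayment u γ S p r) :
    IsSupportedRule u γ S (b + p * postedUtility u γ S p) (greedyLoop u γ S p b) := by
  have hu' : ∀ i, 0 ≤ u i := fun i => (hu i).le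
  fun_induction greedyLoop u γ S p b with
  | case1 p b h hle ih =>
    obtain ⟨l, hl, hsup, heq⟩ := exists_supporting_slope hu hp hinv h
    have hrm := bestNext_mem u γ S p h
    have hpr := (Finset.mem_filter.1 hrm).2.le
    generalize bestNext u γ S p h = r at *
    have := ih (hp.trans hpr) (sub_nonneg.2 hle) ?_
    · convert this using 1
      rw [marginalPayment_eq]
      ring
    -- Both `p` and `r` lie on the supporting line of slope `l`, so slopes into `r` are at least `l`
    -- and slopes out of `r` are at most `l`.
    · rw [marginalPayment_eq] at heq
      intro q hq hqr s hs
      have hrs := (Finset.mem_filter.1 hs).2.le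
      have h1 := hsup q hq
      have h2 := hsup s ((hp.trans hpr).trans hrs)
      have h3 := thresholdCost_mono (γ := γ) (S := S) hu' hq hqr
      have h4 := (marginalPayment_pos hu (hp.trans hpr) hs).le
      rw [marginalPayment_eq] at h4 ⊢
      calc _ ≤ (l * (s * postedUtility u γ S s - r * postedUtility u γ S r)) *
            (r * postedUtility u γ S r - q * postedUtility u γ S q) :=
            mul_le_mul_of_nonneg_right (by linarith) (by linarith)
        _ = (l * (r * postedUtility u γ S r - q * postedUtility u γ S q)) *
            (s * postedUtility u γ S s - r * postedUtility u γ S r) := by ring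
        _ ≤ _ := mul_le_mul_of_nonneg_right (by linarith) h4
  | case2 p b h hlt =>
    obtain ⟨l, hl, hsup, heq⟩ := exists_supporting_slope hu hp hinv h
    have hrm := bestNext_mem u γ S p h
    have hpr := (Finset.mem_filter.1 hrm).2.le
    have hm := marginalPayment_pos hu hp hrm
    generalize bestNext u γ S p h = r at *
    have ht : b / marginalPayment u γ S p r * marginalPayment u γ S p r = b :=
      div_mul_cancel₀ _ hm.ne'
    have ht1 : b / marginalPayment u γ S p r < 1 := (div_lt_one hm).2 (not_le.1 hlt)
    have ht0 : 0 ≤ b / marginalPayment u γ S p r := div_nonneg hb hm.le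
    generalize b / marginalPayment u γ S p r = t at *
    -- The mixture with weight `t` sits on the segment from `p` to `r` of the supporting line, at
    -- cost exactly the whole budget.
    refine ⟨ht0, ht1, hp, hpr, ?_, l, hl, fun q hq => ?_⟩
    · simp only [TwoPriceRule.cost]
      rw [marginalPayment_eq] at ht
      linarith
    · refine (hsup q hq).trans (le_of_eq ?_)
      simp only [TwoPriceRule.value]
      rw [← ht]
      linear_combination (-t) * heq
  | case3 p b h =>
    -- Everything is bought and money may be left over, so the horizontal line certifies optimality.
    refine ⟨le_rfl, zero_lt_one, hp, le_rfl, ?_, 0, le_rfl, fun q hq => ?_⟩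
    · simp only [TwoPriceRule.cost]
      linarith
    · simp only [TwoPriceRule.value]
      rcases le_total q p with hqp | hqp
      · linarith [postedUtility_mono (γ := γ) (S := S) hu' hqp]
      · rcases postedUtility_eq_or_exists_ratio (u := u) (γ := γ) (S := S) hqp with he | ⟨s, hs, -⟩
        · linarith
        · exact absurd ⟨s, hs⟩ h

theorem isSupportedRule_greedy (hu : ∀ i, 0 < u i) (hb : 0 ≤ b) :
    IsSupportedRule u γ S b (greedy u γ S b) := by
  have := isSupportedRule_greedyLoop (γ := γ) (S := S) (p := 0) hu le_rfl hb
    fun q hq hq0 r _ => by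
      obtain rfl := le_antisymm hq0 hq
      simp
  simpa [greedy] using this

/-- Ties are broken by an unspecified choice, which is the same only if the choice problem is
literally the same; hence equality of efficiencies as functions. -/
theorem bestNext_congr {γ' : Fin n → ℝ} (hA : ratiosAbove γ S p = ratiosAbove γ' S p)
    (hE : marginalEfficiency u γ S p = marginalEfficiency u γ' S p)
    (h : (ratiosAbove γ S p).Nonempty) (h' : (ratiosAbove γ' S p).Nonempty) :
    bestNext u γ S p h = bestNext u γ' S p h' := by
  unfold bestNext
  congr 1
  rw [hA, hE]

theorem postedUtility_congr {γ' : Fin n → ℝ} (hγ : ∀ i ∈ S, γ i = γ' i) :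
    postedUtility u γ S = postedUtility u γ' S := by
  funext q
  unfold postedUtility
  congr 1
  exact Finset.filter_congr fun i hi => by rw [hγ i hi]

theorem greedyLoop_congr {γ' : Fin n → ℝ} (hγ : ∀ i ∈ S, γ i = γ' i) :
    greedyLoop u γ S p b = greedyLoop u γ' S p b := by
  have hU := postedUtility_congr (u := u) hγ
  have hA : ∀ p, ratiosAbove γ S p = ratiosAbove γ' S p := fun p => by
    unfold ratiosAbove
    rw [Finset.image_congr hγ]
  have hM : ∀ p q, marginalPayment u γ S p q = marginalPayment u γ' S p q := fun p q => by
    rw [marginalPayment_eq, marginalPayment_eq, hU]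
  have hE : ∀ p, marginalEfficiency u γ S p = marginalEfficiency u γ' S p := fun p => by
    funext q
    rw [marginalEfficiency, marginalEfficiency, hU, hM]
  fun_induction greedyLoop u γ S p b with
  | case1 p b h hle ih =>
    have h' := hA p ▸ h
    have hB := bestNext_congr (hA p) (hE p) h h'
    rw [ih, hM, hB]
    conv_rhs => rw [greedyLoop]
    rw [dif_pos h', if_pos]
    rwa [← hM, ← hB]
  | case2 p b h hlt =>
    have h' := hA p ▸ h
    have hB := bestNext_congr (hA p) (hE p) h h'
    rw [greedyLoop, dif_pos h', if_neg]
    · rw [hM, hB]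
    · rwa [← hM, ← hB]
  | case3 p b h =>
    rw [greedyLoop, dif_neg]
    rwa [← hA]

theorem greedy_congr {γ' : Fin n → ℝ} (hγ : ∀ i ∈ S, γ i = γ' i) :
    greedy u γ S b = greedy u γ' S b :=
  greedyLoop_congr hγ

/-- The value of a supported rule bounds every mixture of two thresholds within the budget. -/
theorem IsSupportedRule.mixture_le {f : TwoPriceRule} (hf : IsSupportedRule u γ S b f)
    (hu : ∀ i, 0 ≤ u i) {q₁ q₂ w₁ w₂ : ℝ} (hq₁ : 0 ≤ q₁) (hq₂ : 0 ≤ q₂) (hw₁ : 0 ≤ w₁)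
    (hw₂ : 0 ≤ w₂) (hw : w₁ + w₂ ≤ 1)
    (hcost : w₁ * (q₁ * postedUtility u γ S q₁) + w₂ * (q₂ * postedUtility u γ S q₂) ≤ b) :
    w₁ * postedUtility u γ S q₁ + w₂ * postedUtility u γ S q₂ ≤ f.value u γ S := by
  obtain ⟨l, hl, hsup⟩ := hf.exists_slope
  have h0 := hsup 0 le_rfl
  have hU0 := postedUtility_nonneg (γ := γ) (S := S) (p := 0) hu
  have h1 := mul_le_mul_of_nonneg_left (hsup q₁ hq₁) hw₁
  have h2 := mul_le_mul_of_nonneg_left (hsup q₂ hq₂) hw₂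
  have h3 := mul_le_mul_of_nonneg_left hcost hl
  -- Unused weight is harmless: the threshold `0` costs nothing, so the supporting line has a
  -- nonnegative intercept.
  have h4 : 0 ≤ (1 - w₁ - w₂) * (f.value u γ S - l * b) :=
    mul_nonneg (by linarith) (by linarith)
  linarith

theorem sum_alloc_eq_value {f : TwoPriceRule} (hf : f.p₁ ≤ f.p₂) :
    ∑ i ∈ S, f.alloc (γ i) * u i = f.value u γ S := by
  rw [TwoPriceRule.value, postedUtility_eq_sum_ite, postedUtility_eq_sum_ite, Finset.mul_sum,
    Finset.mul_sum, ← Finset.sum_add_distrib]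
  refine Finset.sum_congr rfl fun i _ => ?_
  unfold TwoPriceRule.alloc
  split_ifs <;> first | (exfalso; linarith) | ring

theorem greedyUtility_eq (hu : ∀ i, 0 < u i) {B : ℝ} (hB : 0 ≤ B) :
    greedyUtility u γ B = (greedy u γ Finset.univ B).value u γ Finset.univ :=
  sum_alloc_eq_value (isSupportedRule_greedy hu hB).p₁_le_p₂

end GreedyRule

/-! ### Optimality of Greedy among uniform mechanisms, by Lagrangian duality. -/

section UpperBound

variable {u γ : Fin n → ℝ}

/-- Lagrangian bound for a uniform allocation function `g` with truthful payments `y`. -/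
theorem sum_alloc_sub_pay_le (hu : ∀ i, 0 ≤ u i) (hγ : ∀ i, 0 ≤ γ i) {g : ℝ → ℝ}
    {y : Fin n → ℝ → ℝ} {l K : ℝ} (hl : 0 ≤ l) (hK : 0 ≤ K)
    (hg0 : ∀ x, 0 ≤ x → 0 ≤ g x) (hg1 : ∀ x, 0 ≤ x → g x ≤ 1)
    (hanti : ∀ x z, 0 ≤ x → x ≤ z → g z ≤ g x)
    (htruth : ∀ i x z, 0 ≤ x → 0 ≤ z → x * (g x - g z) ≤ y i x - y i z)
    (hir : ∀ i x, 0 ≤ x → x * g x ≤ y i x)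
    (hsup : ∀ q, 0 ≤ q → postedUtility u γ Finset.univ q -
      l * (q * postedUtility u γ Finset.univ q) ≤ K) :
    ∑ i, u i * (g (γ i) - l * y i (γ i)) ≤ K := by
  have hsub : ∀ (S : Finset (Fin n)) (q : ℝ), 0 ≤ q → (∀ i ∈ S, γ i ≤ q) →
      (∑ i ∈ S, u i) * (1 - l * q) ≤ K := by
    intro S q hq hS
    rcases le_or_gt 0 (1 - l * q) with h | h
    · have h1 : ∑ i ∈ S, u i ≤ postedUtility u γ Finset.univ q :=
        Finset.sum_le_sum_of_subset_of_nonneg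
          (fun i hi => Finset.mem_filter.2 ⟨Finset.mem_univ i, hS i hi⟩) fun i _ _ => hu i
      have h2 := mul_le_mul_of_nonneg_right h1 h
      linarith [hsup q hq]
    · exact (mul_nonpos_of_nonneg_of_nonpos (Finset.sum_nonneg fun i _ => hu i) h.le).trans hK
  -- Layer-cake decomposition: from the largest ratio `γ a` in `S` up to `q`, the allocation drops
  -- by `g (γ a) - g q`. Truthfulness makes each seller's payment drop by at least `γ a` times that
  -- amount, so this layer contributes at most `K` times its height. The heights telescope.
  have key : ∀ S : Finset (Fin n), ∀ q, 0 ≤ q → (∀ i ∈ S, γ i ≤ q) →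
      ∑ i ∈ S, u i * ((g (γ i) - g q) - l * (y i (γ i) - y i q)) ≤ K * (1 - g q) := by
    intro S
    induction S using Finset.induction_on_max_value γ with
    | empty =>
      intro q hq _
      simpa using mul_nonneg hK (sub_nonneg.2 (hg1 q hq))
    | insert a S ha hmax ih =>
      intro q hq hS
      have haq : γ a ≤ q := hS a (Finset.mem_insert_self a S)
      have h1 := ih (γ a) (hγ a) hmax
      have h2 : ∑ i ∈ insert a S, u i * ((g (γ a) - g q) - l * (y i (γ a) - y i q)) ≤
          K * (g (γ a) - g q) := by
        have hd : 0 ≤ g (γ a) - g q := sub_nonneg.2 (hanti _ _ (hγ a) haq)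
        calc _ ≤ ∑ i ∈ insert a S, u i * ((1 - l * γ a) * (g (γ a) - g q)) := by
              refine Finset.sum_le_sum fun i _ => mul_le_mul_of_nonneg_left ?_ (hu i)
              have := mul_le_mul_of_nonneg_left (htruth i (γ a) q (hγ a) hq) hl
              linarith
          _ = ((∑ i ∈ insert a S, u i) * (1 - l * γ a)) * (g (γ a) - g q) := by
              rw [← Finset.sum_mul, mul_assoc]
          _ ≤ _ := mul_le_mul_of_nonneg_right (hsub _ _ (hγ a) fun i hi => by
              rcases Finset.mem_insert.1 hi with rfl | hi
              · exact le_rfl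
              · exact hmax i hi) hd
      have h3 : ∑ i ∈ insert a S, u i * ((g (γ i) - g (γ a)) - l * (y i (γ i) - y i (γ a))) =
          ∑ i ∈ S, u i * ((g (γ i) - g (γ a)) - l * (y i (γ i) - y i (γ a))) := by
        rw [Finset.sum_insert ha]
        ring
      have h4 : ∑ i ∈ insert a S, u i * ((g (γ i) - g q) - l * (y i (γ i) - y i q)) =
          ∑ i ∈ insert a S, u i * ((g (γ i) - g (γ a)) - l * (y i (γ i) - y i (γ a))) +
          ∑ i ∈ insert a S, u i * ((g (γ a) - g q) - l * (y i (γ a) - y i q)) := by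
        rw [← Finset.sum_add_distrib]
        exact Finset.sum_congr rfl fun i _ => by ring
      rw [h4, h3]
      linarith
  -- Any common upper bound of the ratios would do. The bottom layer, of height `g q`, has no
  -- further drop; its payment is bounded by individual rationality at the report `q`.
  set q : ℝ := ∑ i, γ i with hqdef
  have hq : 0 ≤ q := Finset.sum_nonneg fun i _ => hγ i
  have hle : ∀ i ∈ Finset.univ, γ i ≤ q := fun i hi =>
    Finset.single_le_sum (f := γ) (fun j _ => hγ j) hi
  have h1 := key Finset.univ q hq hle
  have h2 : ∑ i, u i * (g q - l * y i q) ≤ K * g q :=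
    calc _ ≤ ∑ i, u i * ((1 - l * q) * g q) := by
          refine Finset.sum_le_sum fun i _ => mul_le_mul_of_nonneg_left ?_ (hu i)
          have := mul_le_mul_of_nonneg_left (hir i q hq) hl
          linarith
      _ = ((∑ i, u i) * (1 - l * q)) * g q := by rw [← Finset.sum_mul, mul_assoc]
      _ ≤ _ := mul_le_mul_of_nonneg_right (hsub _ _ hq hle) (hg0 q hq)
  have h3 : ∑ i, u i * (g (γ i) - l * y i (γ i)) =
      ∑ i, u i * ((g (γ i) - g q) - l * (y i (γ i) - y i q)) +
        ∑ i, u i * (g q - l * y i q) := by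
    rw [← Finset.sum_add_distrib]
    exact Finset.sum_congr rfl fun i _ => by ring
  rw [h3]
  linarith

/-- Greedy is optimal among uniform, truthful and individually rational mechanisms. -/
theorem Mechanism.utility_le_greedyUtility {M : Mechanism n} {B : ℝ} (hu : ∀ i, 0 < u i)
    (hB : 0 ≤ B) (hγ : ∀ i, 0 ≤ γ i) (hM : M.Valid) (ht : M.Truthful u)
    (hir : ∀ γ' : Fin n → ℝ, (∀ i, 0 ≤ γ' i) → M.IndividuallyRationalAt u γ')
    (hunif : M.Uniform) (hbud : M.BudgetFeasibleAt u B γ) :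
    M.utility u γ ≤ greedyUtility u γ B := by
  have hu' : ∀ i, 0 ≤ u i := fun i => (hu i).le
  have hupd : ∀ i x, 0 ≤ x → ∀ j, 0 ≤ Function.update γ i x j := by
    intro i x hx j
    rcases eq_or_ne j i with rfl | h
    · simpa using hx
    · simpa [h] using hγ j
  obtain ⟨g, hg⟩ := hunif γ hγ
  have hself : ∀ i, M.alloc γ i = g (γ i) := fun i => by
    simpa using hg i (γ i) (hγ i)
  rw [greedyUtility_eq hu hB]
  have hf := isSupportedRule_greedy (γ := γ) (S := Finset.univ) hu hB
  obtain ⟨l, hl, hsup⟩ := hf.exists_slope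
  have hK : 0 ≤ (greedy u γ Finset.univ B).value u γ Finset.univ - l * B := by
    have := hsup 0 le_rfl
    have := postedUtility_nonneg (γ := γ) (S := Finset.univ) (p := 0) hu'
    linarith
  have htruth : ∀ i x z, 0 ≤ x → 0 ≤ z →
      x * (g x - g z) ≤ M.pay (Function.update γ i x) i - M.pay (Function.update γ i z) i := by
    intro i x z hx hz
    have h := ht _ (hupd i x hx) i z hz
    simp only [Mechanism.profit, Function.update_idem, Function.update_self, hg i x hx,
      hg i z hz] at h
    refine le_of_mul_le_mul_right ?_ (hu i)
    linarith
  -- The range and monotonicity of `g` are read off from the constraints of one seller, so at least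
  -- one seller is needed.
  rcases isEmpty_or_nonempty (Fin n) with hn | ⟨⟨i₀⟩⟩
  · have h0 : M.utility u γ = 0 := by simp [Mechanism.utility]
    have h1 : (greedy u γ Finset.univ B).value u γ Finset.univ = 0 := by
      simp [TwoPriceRule.value, postedUtility, Finset.univ_eq_empty]
    rw [h0, h1]
  have hanti : ∀ x z, 0 ≤ x → x ≤ z → g z ≤ g x := by
    intro x z hx hxz
    rcases hxz.eq_or_lt with rfl | hlt
    · exact le_rfl
    have h1 := htruth i₀ x z hx (hx.trans hxz)
    have h2 := htruth i₀ z x (hx.trans hxz) hx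
    have h3 : 0 ≤ (z - x) * (g x - g z) := by linarith
    linarith [nonneg_of_mul_nonneg_right h3 (sub_pos.2 hlt)]
  have h := sum_alloc_sub_pay_le hu' hγ (g := g)
    (y := fun i x => M.pay (Function.update γ i x) i) hl hK
    (fun x hx => by simpa [hg i₀ x hx] using (hM _ (hupd i₀ x hx) i₀).1)
    (fun x hx => by simpa [hg i₀ x hx] using (hM _ (hupd i₀ x hx) i₀).2.1)
    hanti htruth
    (fun i x hx => by
      have h := hir _ (hupd i x hx) i
      simp only [Mechanism.profit, Function.update_self, hg i x hx] at h
      refine le_of_mul_le_mul_right ?_ (hu i)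
      linarith) hsup
  simp only [Function.update_eq_self] at h
  have h5 : ∑ i, u i * (g (γ i) - l * M.pay γ i) =
      M.utility u γ - l * ∑ i, M.pay γ i * u i := by
    rw [Mechanism.utility, Finset.mul_sum, ← Finset.sum_sub_distrib]
    exact Finset.sum_congr rfl fun i _ => by rw [hself]; ring
  have h6 := mul_le_mul_of_nonneg_left (show ∑ i, M.pay γ i * u i ≤ B from hbud) hl
  rw [h5] at h
  linarith

end UpperBound

/-! ### Partial purchases and posted prices. -/

section Affordable

variable {x p v r : ℝ}

theorem affordable_nonneg (hx : 0 ≤ x) (hp : 0 ≤ p) (hv : 0 ≤ v) (hr : 0 ≤ r) :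
    0 ≤ affordable x p v r := by
  unfold affordable
  split_ifs
  · exact hx
  · exact div_nonneg hr (mul_nonneg hp hv)

/-- A purchase is cut only when its cost exceeds `r ≥ 0`. Then `p * v` is positive and the division
is genuine. -/
theorem affordable_le_and_cost_le (hp : 0 ≤ p) (hv : 0 ≤ v) (hr : 0 ≤ r) :
    affordable x p v r ≤ x ∧ p * affordable x p v r * v ≤ r := by
  unfold affordable
  split_ifs with h
  · exact ⟨le_rfl, by linarith⟩
  · rw [not_le] at h
    have hpv : 0 < p * v := by
      refine (mul_nonneg hp hv).lt_of_ne fun h0 => ?_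
      rw [mul_assoc, ← h0, mul_zero] at h
      linarith
    refine ⟨(div_le_iff₀ hpv).2 (by linarith), le_of_eq ?_⟩
    rw [mul_right_comm, mul_div_cancel₀ _ hpv.ne']

end Affordable

/-- Two-price rules whose steps can be bought one after the other. -/
structure TwoPriceRule.Proper (f : TwoPriceRule) : Prop where
  t_nonneg : 0 ≤ f.t
  t_le_one : f.t ≤ 1
  p₂_nonneg : 0 ≤ f.p₂
  p₁_le_p₂ : f.p₁ ≤ f.p₂

/-- Outcomes (fraction, payment per utility), as a function of the reported ratio, in which a
fraction `a` is offered at price `p₂` and a further fraction `b` at price `p₁`. -/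
def IsPostedPrice (o : ℝ → ℝ × ℝ) : Prop :=
  ∃ a b p₁ p₂ : ℝ, 0 ≤ a ∧ 0 ≤ b ∧ a + b ≤ 1 ∧ 0 ≤ p₂ ∧ ∀ x, 0 ≤ x →
    o x = ((if x ≤ p₂ then a else 0) + (if x ≤ p₁ then b else 0),
      p₂ * (if x ≤ p₂ then a else 0) + p₁ * (if x ≤ p₁ then b else 0))

namespace IsPostedPrice

variable {o : ℝ → ℝ × ℝ} {x : ℝ}

theorem alloc_nonneg (h : IsPostedPrice o) (hx : 0 ≤ x) : 0 ≤ (o x).1 := by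
  obtain ⟨a, b, p₁, p₂, ha, hb, hab, hp, ho⟩ := h
  rw [ho x hx]
  dsimp only
  split_ifs <;> linarith

theorem alloc_le_one (h : IsPostedPrice o) (hx : 0 ≤ x) : (o x).1 ≤ 1 := by
  obtain ⟨a, b, p₁, p₂, ha, hb, hab, hp, ho⟩ := h
  rw [ho x hx]
  dsimp only
  split_ifs <;> linarith

theorem profit_nonneg (h : IsPostedPrice o) (hx : 0 ≤ x) : 0 ≤ (o x).2 - (o x).1 * x := by
  obtain ⟨a, b, p₁, p₂, ha, hb, hab, hp, ho⟩ := h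
  rw [ho x hx]
  dsimp only
  split_ifs <;> nlinarith

theorem pay_nonneg (h : IsPostedPrice o) (hx : 0 ≤ x) : 0 ≤ (o x).2 := by
  have := h.profit_nonneg hx
  have := mul_nonneg (h.alloc_nonneg hx) hx
  linarith

theorem truthful (h : IsPostedPrice o) (hx : 0 ≤ x) {z : ℝ} (hz : 0 ≤ z) :
    (o z).2 - (o z).1 * x ≤ (o x).2 - (o x).1 * x := by
  obtain ⟨a, b, p₁, p₂, ha, hb, hab, hp, ho⟩ := h
  rw [ho x hx, ho z hz]
  have key : ∀ p w : ℝ, 0 ≤ w → p * (if z ≤ p then w else 0) - (if z ≤ p then w else 0) * x ≤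
      p * (if x ≤ p then w else 0) - (if x ≤ p then w else 0) * x := by
    intro p w hw
    split_ifs <;> nlinarith
  dsimp only
  linarith [key p₁ b hb, key p₂ a ha]

theorem zero : IsPostedPrice fun _ => (0, 0) :=
  ⟨0, 0, 0, 0, le_rfl, le_rfl, by norm_num, le_rfl, fun x _ => by simp⟩

end IsPostedPrice

namespace TwoPriceRule

variable {f : TwoPriceRule} {v x r : ℝ}

/-- As `p₁ ≤ p₂`, whoever accepts `p₁` also accepts `p₂`. Hence the money left for the second offer
is the same for every report that can use it, even when money runs short. -/
theorem Proper.isPostedPrice_applyTo (hf : f.Proper) (hv : 0 ≤ v) (hr : 0 ≤ r) :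
    IsPostedPrice fun x => f.applyTo v x r := by
  have ha := affordable_nonneg hf.t_nonneg hf.p₂_nonneg hv hr
  obtain ⟨ha1, ha2⟩ := affordable_le_and_cost_le hf.p₂_nonneg hv hr
  -- For a truncated rule the second amount is set to `0`: no nonnegative report accepts a negative
  -- price.
  rcases lt_or_ge f.p₁ 0 with hp | hp
  · refine ⟨affordable f.t f.p₂ v r, 0, f.p₁, f.p₂, ha, le_rfl, ?_, hf.p₂_nonneg, ?_⟩
    · linarith [hf.t_le_one]
    · intro x hx
      simp only [applyTo, soldAtP₁, soldAtP₂, if_neg (not_le.2 (hp.trans_le hx))]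
  · have hr' : 0 ≤ r - f.p₂ * v * affordable f.t f.p₂ v r := by linarith
    have ht : 0 ≤ 1 - f.t := sub_nonneg.2 hf.t_le_one
    refine ⟨affordable f.t f.p₂ v r,
      affordable (1 - f.t) f.p₁ v (r - f.p₂ * v * affordable f.t f.p₂ v r), f.p₁, f.p₂, ha,
      affordable_nonneg ht hp hv hr', ?_, hf.p₂_nonneg, ?_⟩
    · linarith [(affordable_le_and_cost_le (x := 1 - f.t) hp hv hr').1]
    · intro x _
      by_cases h : x ≤ f.p₁
      · simp only [applyTo, soldAtP₁, soldAtP₂, if_pos h, if_pos (h.trans hf.p₁_le_p₂)]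
      · simp only [applyTo, soldAtP₁, soldAtP₂, if_neg h]

theorem Proper.applyTo_cost_le (hf : f.Proper) (hv : 0 ≤ v) (hx : 0 ≤ x) (hr : 0 ≤ r) :
    (f.applyTo v x r).2 * v ≤ r := by
  have ha2 : f.p₂ * v * f.soldAtP₂ v x r ≤ r := by
    unfold soldAtP₂
    split_ifs
    · linarith [(affordable_le_and_cost_le (x := f.t) hf.p₂_nonneg hv hr).2]
    · simpa using hr
  have hb : f.p₁ * v * f.soldAtP₁ v x r ≤ r - f.p₂ * v * f.soldAtP₂ v x r := by
    unfold soldAtP₁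
    split_ifs with h
    · linarith [(affordable_le_and_cost_le (x := 1 - f.t) (hx.trans h) hv
        (sub_nonneg.2 ha2)).2]
    · simpa using ha2
  simp only [applyTo]
  linarith

/-- Myerson payment per utility of a two-price rule. -/
noncomputable def payment (f : TwoPriceRule) (x : ℝ) : ℝ :=
  f.p₂ * (if x ≤ f.p₂ then f.t else 0) + f.p₁ * (if x ≤ f.p₁ then 1 - f.t else 0)

theorem Proper.payment_nonneg (hf : f.Proper) (hx : 0 ≤ x) : 0 ≤ f.payment x := by
  unfold payment
  refine add_nonneg (mul_nonneg hf.p₂_nonneg ?_) ?_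
  · split_ifs
    · exact hf.t_nonneg
    · exact le_rfl
  · split_ifs with h
    · exact mul_nonneg (hx.trans h) (sub_nonneg.2 hf.t_le_one)
    · simp

theorem Proper.applyTo_of_payment_le (hf : f.Proper) (hv : 0 ≤ v) (hx : 0 ≤ x)
    (h : f.payment x * v ≤ r) : f.applyTo v x r = (f.alloc x, f.payment x) := by
  have ht : 0 ≤ 1 - f.t := sub_nonneg.2 hf.t_le_one
  unfold payment at h
  by_cases h2 : x ≤ f.p₂
  · by_cases h1 : x ≤ f.p₁
    · have h0 := mul_nonneg (mul_nonneg (hx.trans h1) ht) hv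
      simp only [if_pos h1, if_pos h2] at h
      have e2 : affordable f.t f.p₂ v r = f.t := if_pos (by linarith)
      have e1 : affordable (1 - f.t) f.p₁ v (r - f.p₂ * v * f.t) = 1 - f.t :=
        if_pos (by linarith)
      simp only [applyTo, soldAtP₁, soldAtP₂, alloc, payment, if_pos h1, if_pos h2, e1, e2,
        add_sub_cancel]
    · simp only [if_neg h1, if_pos h2] at h
      have e2 : affordable f.t f.p₂ v r = f.t := if_pos (by linarith)
      simp only [applyTo, soldAtP₁, soldAtP₂, alloc, payment, if_neg h1, if_pos h2, e2, add_zero]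
  · have h1 : ¬ x ≤ f.p₁ := fun h1 => h2 (h1.trans hf.p₁_le_p₂)
    simp only [applyTo, soldAtP₁, soldAtP₂, alloc, payment, if_neg h1, if_neg h2, add_zero]

theorem sum_payment_eq_cost {u γ : Fin n → ℝ} {S : Finset (Fin n)} :
    ∑ i ∈ S, f.payment (γ i) * u i = f.cost u γ S := by
  rw [cost, postedUtility_eq_sum_ite, postedUtility_eq_sum_ite]
  simp only [Finset.mul_sum]
  rw [← Finset.sum_add_distrib]
  refine Finset.sum_congr rfl fun i _ => ?_
  unfold payment
  split_ifs <;> ring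

end TwoPriceRule

/-! ### Spending a budget along a list of sellers. -/

section Sequential

variable {f : TwoPriceRule} {u γ : Fin n → ℝ} {r : ℝ} {l : List (Fin n)} {i : Fin n}

/-- The money left when `i` is reached depends only on the reports of earlier sellers. -/
theorem isPostedPrice_applySequentially (hf : f.Proper) (hu : ∀ i, 0 ≤ u i)
    (hγ : ∀ i, 0 ≤ γ i) (hr : 0 ≤ r) (i : Fin n) :
    IsPostedPrice fun z => applySequentially f u (Function.update γ i z) r l i := by
  induction l generalizing r with
  | nil => exact IsPostedPrice.zero
  | cons j l ih =>
    by_cases h : i = j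
    · subst h
      simpa [applySequentially] using hf.isPostedPrice_applyTo (hu i) hr
    · simp only [applySequentially, if_neg h, Function.update_of_ne (Ne.symm h)]
      exact ih (sub_nonneg.2 (hf.applyTo_cost_le (hu j) (hγ j) hr))

theorem sum_applySequentially_le (hf : f.Proper) (hu : ∀ i, 0 ≤ u i) (hγ : ∀ i, 0 ≤ γ i)
    (hr : 0 ≤ r) (hl : l.Nodup) :
    ∑ i ∈ l.toFinset, (applySequentially f u γ r l i).2 * u i ≤ r := by
  induction l generalizing r with
  | nil => simpa using hr
  | cons j l ih =>
    obtain ⟨hj, hl⟩ := List.nodup_cons.1 hl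
    have h1 := ih (sub_nonneg.2 (hf.applyTo_cost_le (hu j) (hγ j) hr)) hl
    rw [List.toFinset_cons, Finset.sum_insert (by simpa using hj)]
    have h2 : ∑ i ∈ l.toFinset, (applySequentially f u γ r (j :: l) i).2 * u i =
        ∑ i ∈ l.toFinset,
          (applySequentially f u γ (r - (f.applyTo (u j) (γ j) r).2 * u j) l i).2 * u i := by
      refine Finset.sum_congr rfl fun i hi => ?_
      have hij : i ≠ j := fun e => hj (by simpa [e] using hi)
      simp only [applySequentially, if_neg hij]
    rw [h2]
    simp only [applySequentially, if_true]
    linarith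

theorem applySequentially_of_cost_le (hf : f.Proper) (hu : ∀ i, 0 ≤ u i) (hγ : ∀ i, 0 ≤ γ i)
    (hl : l.Nodup) (hr : f.cost u γ l.toFinset ≤ r) (hi : i ∈ l) :
    applySequentially f u γ r l i = (f.alloc (γ i), f.payment (γ i)) := by
  induction l generalizing r with
  | nil => simp at hi
  | cons j l ih =>
    obtain ⟨hj, hl⟩ := List.nodup_cons.1 hl
    rw [← TwoPriceRule.sum_payment_eq_cost, List.toFinset_cons,
      Finset.sum_insert (by simpa using hj), TwoPriceRule.sum_payment_eq_cost] at hr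
    have h0 : 0 ≤ f.cost u γ l.toFinset := by
      rw [← TwoPriceRule.sum_payment_eq_cost]
      exact Finset.sum_nonneg fun i _ => mul_nonneg (hf.payment_nonneg (hγ i)) (hu i)
    have h1 := hf.applyTo_of_payment_le (hu j) (hγ j) (r := r) (by linarith)
    by_cases h : i = j
    · subst h
      simpa [applySequentially] using h1
    · simp only [applySequentially, if_neg h, h1]
      exact ih hl (by linarith) ((List.mem_cons.1 hi).resolve_left h)

end Sequential

/-! ### The set of sellers of highest utility. -/

section TopSellers

variable {u : Fin n → ℝ} {C : ℕ} {i j : Fin n}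

/-- The sellers that precede `i` in the order of decreasing utility. -/
noncomputable def precedingSellers (u : Fin n → ℝ) (i : Fin n) : Finset (Fin n) :=
  {j | u i < u j ∨ (u j = u i ∧ j < i)}

theorem mem_precedingSellers : j ∈ precedingSellers u i ↔ u i < u j ∨ (u j = u i ∧ j < i) := by
  simp [precedingSellers]

theorem mem_topSellers : i ∈ topSellers u C ↔ (precedingSellers u i).card < C := by
  simp [topSellers, precedingSellers]

theorem card_precedingSellers_lt (h : j ∈ precedingSellers u i) :
    (precedingSellers u j).card < (precedingSellers u i).card := by
  refine Finset.card_lt_card (Finset.ssubset_iff_of_subset ?_ |>.2 ⟨j, h, ?_⟩)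
  · intro k hk
    rw [mem_precedingSellers] at h hk ⊢
    rcases h with h | ⟨h, h'⟩ <;> rcases hk with hk | ⟨hk, hk'⟩
    · exact Or.inl (h.trans hk)
    · exact Or.inl (hk ▸ h)
    · exact Or.inl (h ▸ hk)
    · exact Or.inr ⟨hk.trans h, hk'.trans h'⟩
  · simp [mem_precedingSellers]

theorem mem_precedingSellers_of_card_lt
    (h : (precedingSellers u j).card < (precedingSellers u i).card) :
    j ∈ precedingSellers u i := by
  by_contra hji
  have hij : i ∉ precedingSellers u j := fun h' => (card_precedingSellers_lt h').not_gt h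
  rw [mem_precedingSellers] at hij hji
  push Not at hij hji
  have hu : u i = u j := le_antisymm hij.1 hji.1
  have : i = j := le_antisymm (hji.2 hu.symm) (hij.2 hu)
  subst this
  exact lt_irrefl _ h

theorem card_precedingSellers_injective :
    Function.Injective fun i => (precedingSellers u i).card := by
  intro i j h
  have hij : i ∉ precedingSellers u j := fun h' => (card_precedingSellers_lt h').ne h
  have hji : j ∉ precedingSellers u i := fun h' => (card_precedingSellers_lt h').ne h.symm
  rw [mem_precedingSellers] at hij hji
  push Not at hij hji
  have hu : u i = u j := le_antisymm hij.1 hji.1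
  exact le_antisymm (hji.2 hu.symm) (hij.2 hu)

theorem card_topSellers_le : (topSellers u C).card ≤ C := by
  calc _ ≤ (Finset.range C).card :=
        Finset.card_le_card_of_injOn (fun i => (precedingSellers u i).card)
          (fun i hi => by simpa using mem_topSellers.1 hi) card_precedingSellers_injective.injOn
    _ = C := Finset.card_range C

/-- The number of preceding sellers is a rank, injective with values below `n`, hence onto. Every
rank below `C` is thus taken by a top seller. -/
theorem le_card_topSellers (h : i ∉ topSellers u C) : C ≤ (topSellers u C).card := by
  rw [mem_topSellers, not_lt] at h
  have hlt : ∀ i, (precedingSellers u i).card < n := fun i => by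
    have := Finset.card_lt_univ_of_notMem (x := i) (s := precedingSellers u i)
      (by simp [mem_precedingSellers])
    simpa using this
  have hsurj : Function.Surjective fun i => (⟨(precedingSellers u i).card, hlt i⟩ : Fin n) :=
    Finite.surjective_of_injective fun i j hij =>
      card_precedingSellers_injective (Fin.mk.inj_iff.1 hij)
  calc C = (Finset.range C).card := (Finset.card_range C).symm
    _ ≤ ((topSellers u C).image fun i => (precedingSellers u i).card).card := by
        refine Finset.card_le_card fun k hk => ?_
        have hk := Finset.mem_range.1 hk
        obtain ⟨j, hj⟩ := hsurj ⟨k, (hk.trans_le h).trans (hlt i)⟩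
        have hj : (precedingSellers u j).card = k := Fin.mk.inj_iff.1 hj
        exact Finset.mem_image.2 ⟨j, mem_topSellers.2 (hj ▸ hk), hj⟩
    _ ≤ _ := Finset.card_image_le

/-- A seller outside the top set has at most the average utility of the top set. -/
theorem utility_le_of_notMem_topSellers (hu : ∀ i, 0 ≤ u i) (hC : 0 < C)
    (h : i ∉ topSellers u C) : u i ≤ (∑ j ∈ topSellers u C, u j) / C := by
  have hC' : (0 : ℝ) < C := by exact_mod_cast hC
  rw [le_div_iff₀ hC']
  have h1 : ((topSellers u C).card : ℝ) * u i ≤ ∑ j ∈ topSellers u C, u j := by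
    rw [← nsmul_eq_mul]
    refine Finset.card_nsmul_le_sum _ _ _ fun j hj => ?_
    have hlt := (mem_topSellers.1 hj).trans_le (not_lt.1 fun h' => h (mem_topSellers.2 h'))
    rcases mem_precedingSellers.1 (mem_precedingSellers_of_card_lt hlt) with h2 | h2
    · exact h2.le
    · exact h2.1.ge
  have h2 : (C : ℝ) ≤ (topSellers u C).card := by exact_mod_cast le_card_topSellers h
  linarith [mul_le_mul_of_nonneg_right h2 (hu i)]

end TopSellers

/-! ### Incentives and budget of Random-Sampling-Greedy. -/

section Sample

variable {u γ : Fin n → ℝ} {B ε₁ δ₁ η : ℝ} {C : ℕ} {σ : Equiv.Perm (Fin n)}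
  {S W : Finset (Fin n)} {i : Fin n}

/-- The truncated rule that Random-Sampling-Greedy learns from the sample `S`. -/
noncomputable def sampleRule (u γ : Fin n → ℝ) (B δ₁ η : ℝ) (C : ℕ) (S : Finset (Fin n)) :
    TwoPriceRule :=
  truncate u γ η C S (greedy u γ S ((1 - δ₁) * B / 2))

theorem sampleRule_congr {γ' : Fin n → ℝ} (hγ : ∀ i ∈ S, γ i = γ' i) :
    sampleRule u γ B δ₁ η C S = sampleRule u γ' B δ₁ η C S := by
  rw [sampleRule, sampleRule, truncate, truncate, greedy_congr hγ, postedUtility_congr hγ]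

theorem sampleRule_proper (hu : ∀ i, 0 < u i) (hB : 0 ≤ B) (hδ : δ₁ ≤ 1) :
    (sampleRule u γ B δ₁ η C S).Proper := by
  have hb : 0 ≤ (1 - δ₁) * B / 2 := by
    have := mul_nonneg (sub_nonneg.2 hδ) hB
    linarith
  have h := isSupportedRule_greedy (γ := γ) (S := S) hu hb
  have h2 := h.p₁_nonneg.trans h.p₁_le_p₂
  unfold sampleRule truncate
  split_ifs
  · exact ⟨h.t_nonneg, h.t_lt_one.le, h2, by dsimp only; linarith⟩
  · exact ⟨h.t_nonneg, h.t_lt_one.le, h2, h.p₁_le_p₂⟩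

/-- The sellers in `S` in their processing order. -/
noncomputable def processingOrder (σ : Equiv.Perm (Fin n)) (S : Finset (Fin n)) :
    List (Fin n) :=
  ((List.finRange n).map σ).filter (fun j => j ∈ S)

theorem mem_processingOrder : i ∈ processingOrder σ S ↔ i ∈ S := by
  simp only [processingOrder, List.mem_filter, List.mem_map, List.mem_finRange, true_and,
    decide_eq_true_eq, and_iff_right_iff_imp]
  exact fun _ => ⟨σ.symm i, by simp⟩

theorem nodup_processingOrder : (processingOrder σ S).Nodup :=
  ((List.nodup_finRange n).map σ.injective).filter _

theorem toFinset_processingOrder : (processingOrder σ S).toFinset = S := by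
  ext i
  rw [List.mem_toFinset, mem_processingOrder]

theorem rsgOutcome_of_mem_top (hi : i ∈ topSellers u C) :
    rsgOutcome u B ε₁ δ₁ η C σ W γ i = (1, ε₁ * B / C / u i) := by
  simp only [rsgOutcome, if_pos hi]

theorem rsgOutcome_of_mem_right (hi : i ∈ (topSellers u C ∪ W)ᶜ) :
    rsgOutcome u B ε₁ δ₁ η C σ W γ i =
      applySequentially (sampleRule u γ B δ₁ η C (W \ topSellers u C)) u γ ((1 - ε₁) * B / 2)
        (processingOrder σ (topSellers u C ∪ W)ᶜ) i := by
  have hT : i ∉ topSellers u C := fun h =>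
    Finset.mem_compl.1 hi (Finset.mem_union_left _ h)
  simp only [rsgOutcome, if_neg hT, if_pos hi]
  rfl

theorem rsgOutcome_of_mem_left (hi : i ∈ W \ topSellers u C) :
    rsgOutcome u B ε₁ δ₁ η C σ W γ i =
      applySequentially (sampleRule u γ B δ₁ η C (topSellers u C ∪ W)ᶜ) u γ ((1 - ε₁) * B / 2)
        (processingOrder σ (W \ topSellers u C)) i := by
  obtain ⟨hW, hT⟩ := Finset.mem_sdiff.1 hi
  have hY : i ∉ (topSellers u C ∪ W)ᶜ := fun h =>
    Finset.mem_compl.1 h (Finset.mem_union_right _ hW)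
  simp only [rsgOutcome, if_neg hT, if_neg hY]
  rfl

theorem mem_left_or_mem_right (W : Finset (Fin n)) (hi : i ∉ topSellers u C) :
    i ∈ W \ topSellers u C ∨ i ∈ (topSellers u C ∪ W)ᶜ := by
  by_cases hW : i ∈ W
  · exact Or.inl (Finset.mem_sdiff.2 ⟨hW, hi⟩)
  · exact Or.inr (by simp [hi, hW])

theorem sum_eq_top_add_left_add_right (T W : Finset (Fin n)) (g : Fin n → ℝ) :
    ∑ i, g i = ∑ i ∈ T, g i + ∑ i ∈ W \ T, g i + ∑ i ∈ (T ∪ W)ᶜ, g i := by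
  rw [← Finset.sum_union Finset.disjoint_sdiff, Finset.union_sdiff_self_eq_union,
    Finset.sum_add_sum_compl]

/-- The rule applied to `i` is learned from the half that does not contain `i`, so a change of the
report of `i` leaves it unchanged. -/
theorem isPostedPrice_rsgOutcome (hu : ∀ i, 0 < u i) (hB : 0 ≤ B) (hε : ε₁ ≤ 1) (hδ : δ₁ ≤ 1)
    (hγ : ∀ i, 0 ≤ γ i) (hi : i ∉ topSellers u C) :
    IsPostedPrice fun z => rsgOutcome u B ε₁ δ₁ η C σ W (Function.update γ i z) i := by
  have hr : 0 ≤ (1 - ε₁) * B / 2 := by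
    have := mul_nonneg (sub_nonneg.2 hε) hB
    linarith
  have hcongr : ∀ S : Finset (Fin n), i ∉ S → ∀ z,
      sampleRule u (Function.update γ i z) B δ₁ η C S = sampleRule u γ B δ₁ η C S :=
    fun S hS z => sampleRule_congr fun j hj =>
      Function.update_of_ne (ne_of_mem_of_not_mem hj hS) z γ
  rcases mem_left_or_mem_right W hi with h | h
  · have hn : i ∉ (topSellers u C ∪ W)ᶜ := fun h' =>
      Finset.mem_compl.1 h' (Finset.mem_union_right _ (Finset.mem_sdiff.1 h).1)
    simp only [rsgOutcome_of_mem_left h, hcongr _ hn]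
    exact isPostedPrice_applySequentially (sampleRule_proper hu hB hδ) (fun i => (hu i).le) hγ hr i
  · have hn : i ∉ W \ topSellers u C := fun h' =>
      Finset.mem_compl.1 h (Finset.mem_union_right _ (Finset.mem_sdiff.1 h').1)
    simp only [rsgOutcome_of_mem_right h, hcongr _ hn]
    exact isPostedPrice_applySequentially (sampleRule_proper hu hB hδ) (fun i => (hu i).le) hγ hr i

theorem valid_randomSamplingGreedy (hu : ∀ i, 0 < u i) (hB : 0 ≤ B) (hε0 : 0 ≤ ε₁)
    (hε : ε₁ ≤ 1) (hδ : δ₁ ≤ 1) (W : Finset (Fin n)) :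
    ((randomSamplingGreedy u B ε₁ δ₁ η C σ).run W).Valid := by
  intro γ hγ i
  change 0 ≤ (rsgOutcome u B ε₁ δ₁ η C σ W γ i).1 ∧ (rsgOutcome u B ε₁ δ₁ η C σ W γ i).1 ≤ 1 ∧
    0 ≤ (rsgOutcome u B ε₁ δ₁ η C σ W γ i).2
  by_cases hi : i ∈ topSellers u C
  · rw [rsgOutcome_of_mem_top hi]
    exact ⟨zero_le_one, le_rfl,
      div_nonneg (div_nonneg (mul_nonneg hε0 hB) (Nat.cast_nonneg C)) (hu i).le⟩
  · have h := isPostedPrice_rsgOutcome (η := η) (σ := σ) (W := W) hu hB hε hδ hγ hi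
    have h1 := h.alloc_nonneg (hγ i)
    have h2 := h.alloc_le_one (hγ i)
    have h3 := h.pay_nonneg (hγ i)
    rw [Function.update_eq_self] at h1 h2 h3
    exact ⟨h1, h2, h3⟩

theorem truthful_randomSamplingGreedy_run (hu : ∀ i, 0 < u i) (hB : 0 ≤ B) (hε : ε₁ ≤ 1)
    (hδ : δ₁ ≤ 1) (W : Finset (Fin n)) :
    ((randomSamplingGreedy u B ε₁ δ₁ η C σ).run W).Truthful u := by
  intro γ hγ i z hz
  change (rsgOutcome u B ε₁ δ₁ η C σ W (Function.update γ i z) i).2 * u i -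
      (rsgOutcome u B ε₁ δ₁ η C σ W (Function.update γ i z) i).1 * (γ i * u i) ≤
    (rsgOutcome u B ε₁ δ₁ η C σ W γ i).2 * u i -
      (rsgOutcome u B ε₁ δ₁ η C σ W γ i).1 * (γ i * u i)
  by_cases hi : i ∈ topSellers u C
  · rw [rsgOutcome_of_mem_top hi, rsgOutcome_of_mem_top hi]
  · have h := (isPostedPrice_rsgOutcome (η := η) (σ := σ) (W := W) hu hB hε hδ hγ hi).truthful
      (hγ i) hz
    simp only [Function.update_eq_self] at h
    have := mul_le_mul_of_nonneg_right h (hu i).le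
    linarith

theorem RandomizedMechanism.truthfulInExpectation_of_run {R : RandomizedMechanism n}
    (h : ∀ ω, (R.run ω).Truthful u) : R.TruthfulInExpectation u := by
  have hprofit : ∀ γ i x, R.expected.profit u γ i x =
      ∑ ω, (R.law ω).toReal * (R.run ω).profit u γ i x := by
    intro γ i x
    simp only [Mechanism.profit, RandomizedMechanism.expected, Finset.sum_mul]
    rw [← Finset.sum_sub_distrib]
    exact Finset.sum_congr rfl fun ω _ => by ring
  intro γ hγ i z hz
  rw [hprofit, hprofit]
  exact Finset.sum_le_sum fun ω _ =>
    mul_le_mul_of_nonneg_left (h ω γ hγ i z hz) ENNReal.toReal_nonneg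

theorem strictlyBudgetFeasible_randomSamplingGreedy (hu : ∀ i, 0 < u i) (hB : 0 ≤ B)
    (hε0 : 0 ≤ ε₁) (hε : ε₁ ≤ 1) (hδ : δ₁ ≤ 1) (hC : 0 < C) :
    (randomSamplingGreedy u B ε₁ δ₁ η C σ).StrictlyBudgetFeasible u B := by
  intro (W : Finset (Fin n)) _ γ hγ
  change ∑ i, (rsgOutcome u B ε₁ δ₁ η C σ W γ i).2 * u i ≤ B
  have hr : 0 ≤ (1 - ε₁) * B / 2 := by
    have := mul_nonneg (sub_nonneg.2 hε) hB
    linarith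
  have hseq : ∀ S S' : Finset (Fin n),
      ∑ i ∈ S, (applySequentially (sampleRule u γ B δ₁ η C S') u γ ((1 - ε₁) * B / 2)
        (processingOrder σ S) i).2 * u i ≤ (1 - ε₁) * B / 2 := by
    intro S S'
    have := sum_applySequentially_le (sampleRule_proper (γ := γ) (η := η) (C := C) (S := S')
      hu hB hδ) (fun i => (hu i).le) hγ hr (nodup_processingOrder (σ := σ) (S := S))
    rwa [toFinset_processingOrder] at this
  have hC' : (0 : ℝ) < C := by exact_mod_cast hC
  rw [sum_eq_top_add_left_add_right (topSellers u C) W]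
  have h1 : ∑ i ∈ topSellers u C, (rsgOutcome u B ε₁ δ₁ η C σ W γ i).2 * u i ≤ ε₁ * B :=
    calc _ = ∑ i ∈ topSellers u C, ε₁ * B / C := Finset.sum_congr rfl fun i hi => by
          rw [rsgOutcome_of_mem_top hi]
          exact div_mul_cancel₀ _ (hu i).ne'
      _ = (topSellers u C).card * (ε₁ * B / C) := by rw [Finset.sum_const, nsmul_eq_mul]
      _ ≤ C * (ε₁ * B / C) := mul_le_mul_of_nonneg_right
          (by exact_mod_cast card_topSellers_le) (div_nonneg (mul_nonneg hε0 hB) hC'.le)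
      _ = ε₁ * B := mul_div_cancel₀ _ hC'.ne'
  have h2 := hseq (W \ topSellers u C) (topSellers u C ∪ W)ᶜ
  have h3 := hseq (topSellers u C ∪ W)ᶜ (W \ topSellers u C)
  rw [Finset.sum_congr rfl fun i hi => by rw [← rsgOutcome_of_mem_left hi]] at h2
  rw [Finset.sum_congr rfl fun i hi => by rw [← rsgOutcome_of_mem_right hi]] at h3
  linarith

theorem individuallyRationalAt_randomSamplingGreedy (hu : ∀ i, 0 < u i) (hB : 0 ≤ B)
    (hε : ε₁ ≤ 1) (hδ : δ₁ ≤ 1) (hγ : ∀ i, 0 ≤ γ i) (hc : ∀ i, γ i * u i ≤ ε₁ * B / C)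
    (W : Finset (Fin n)) :
    ((randomSamplingGreedy u B ε₁ δ₁ η C σ).run W).IndividuallyRationalAt u γ := by
  intro i
  change 0 ≤ (rsgOutcome u B ε₁ δ₁ η C σ W γ i).2 * u i -
      (rsgOutcome u B ε₁ δ₁ η C σ W γ i).1 * (γ i * u i)
  by_cases hi : i ∈ topSellers u C
  · rw [rsgOutcome_of_mem_top hi]
    dsimp only
    rw [div_mul_cancel₀ _ (hu i).ne', one_mul]
    exact sub_nonneg.2 (hc i)
  · have h := (isPostedPrice_rsgOutcome (η := η) (σ := σ) (W := W) hu hB hε hδ hγ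
      hi).profit_nonneg (hγ i)
    rw [Function.update_eq_self] at h
    have := mul_nonneg h (hu i).le
    linarith

end Sample

/-! ### A maximal inequality for random splits. -/

section Concentration

variable {ι : Type*} [DecidableEq ι]

open Classical in
/-- Maximal inequality for the exponential supermartingale of the signed prefix sums of weights
`v i ∈ [0, θ]`, where the signs are given by a uniformly random subset `A` of `s`. -/
theorem card_exists_prefix_ge_le (γ v : ι → ℝ) {θ : ℝ} (μ : ℝ) (hv : ∀ i, 0 ≤ v i)
    (hvθ : ∀ i, v i ≤ θ) (s : Finset ι) (a : ℝ) :
    ∑ A ∈ s.powerset, (if ∃ p, a ≤ ∑ i ∈ s with γ i ≤ p,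
        (μ * (if i ∈ A then v i else -v i) - μ ^ 2 * θ * v i / 2) then (1 : ℝ) else 0) ≤
      2 ^ s.card * Real.exp (-a) := by
  induction s using Finset.induction_on_min_value γ generalizing a with
  | empty =>
    simp only [Finset.powerset_empty, Finset.sum_singleton, Finset.filter_empty, Finset.sum_empty,
      exists_const, Finset.card_empty, pow_zero, one_mul]
    split_ifs with h
    · exact Real.one_le_exp (by linarith)
    · exact (Real.exp_pos _).le
  | insert x s hx hmin ih =>
    rcases le_or_gt a 0 with ha | ha
    · calc _ ≤ ∑ A ∈ (insert x s).powerset, (1 : ℝ) :=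
            Finset.sum_le_sum fun A _ => by split_ifs <;> norm_num
        _ = 2 ^ (insert x s).card * 1 := by simp
        _ ≤ _ := mul_le_mul_of_nonneg_left (Real.one_le_exp (by linarith)) (by positivity)
    -- The element `x` of smallest ratio comes first. As `a > 0`, a prefix reaching `a` is nonempty
    -- and contains `x`, so the remaining elements must reach `a` minus the contribution `y` of `x`.
    have hstep : ∀ (A A' : Finset ι) (y : ℝ), (∀ i ∈ s, i ∈ A' ↔ i ∈ A) →
        μ * (if x ∈ A' then v x else -v x) - μ ^ 2 * θ * v x / 2 = y →
        (∃ p, a ≤ ∑ i ∈ insert x s with γ i ≤ p,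
          (μ * (if i ∈ A' then v i else -v i) - μ ^ 2 * θ * v i / 2)) →
        ∃ p, a - y ≤ ∑ i ∈ s with γ i ≤ p,
          (μ * (if i ∈ A then v i else -v i) - μ ^ 2 * θ * v i / 2) := by
      rintro A A' y hA hy ⟨p, hp⟩
      refine ⟨p, ?_⟩
      rcases lt_or_ge p (γ x) with hpx | hpx
      · rw [Finset.filter_false_of_mem, Finset.sum_empty] at hp
        · linarith
        · intro i hi
          rcases Finset.mem_insert.1 hi with rfl | hi
          · exact not_le.2 hpx
          · exact not_le.2 (hpx.trans_le (hmin i hi))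
      · rw [Finset.filter_insert, if_pos hpx, Finset.sum_insert (by simp [hx]), hy] at hp
        rw [Finset.sum_congr rfl fun i hi => by
          rw [if_congr (hA i (Finset.mem_filter.1 hi).1) rfl rfl]] at hp
        linarith
    rw [Finset.sum_powerset_insert hx]
    have h1 := ih (a - (-(μ * v x) - μ ^ 2 * θ * v x / 2))
    have h2 := ih (a - (μ * v x - μ ^ 2 * θ * v x / 2))
    have hmono : ∀ P Q : Prop, (P → Q) →
        (if P then (1 : ℝ) else 0) ≤ if Q then (1 : ℝ) else 0 := by
      intro P Q h
      split_ifs with hP hQ <;> first | exact absurd (h hP) hQ | norm_num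
    have h3 := (Finset.sum_le_sum fun A hA => hmono _ _ (hstep A A
      (-(μ * v x) - μ ^ 2 * θ * v x / 2) (fun _ _ => Iff.rfl)
      (by rw [if_neg fun h => hx (Finset.mem_powerset.1 hA h)]; ring))).trans h1
    have h4 := (Finset.sum_le_sum fun A hA => hmono _ _ (hstep A (insert x A)
      (μ * v x - μ ^ 2 * θ * v x / 2)
      (fun i hi => by
        have : i ≠ x := fun e => hx (e ▸ hi)
        simp [this])
      (by rw [if_pos (Finset.mem_insert_self x A)]))).trans h2
    refine (add_le_add h3 h4).trans ?_
    -- By `v x ^ 2 ≤ θ * v x`, a compensator linear in `v x` suffices. This is what makes the final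
    -- deviation relative to the prefix sum.
    have hcosh : Real.cosh (μ * v x) ≤ Real.exp (μ ^ 2 * θ * v x / 2) := by
      refine (Real.cosh_le_exp_half_sq _).trans (Real.exp_le_exp.2 ?_)
      have := mul_le_mul_of_nonneg_left (mul_le_mul_of_nonneg_right (hvθ x) (hv x)) (sq_nonneg μ)
      nlinarith
    have e1 : Real.exp (-(a - (-(μ * v x) - μ ^ 2 * θ * v x / 2))) =
        Real.exp (-a) * Real.exp (-(μ ^ 2 * θ * v x / 2)) * Real.exp (-(μ * v x)) := by
      rw [← Real.exp_add, ← Real.exp_add]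
      ring_nf
    have e2 : Real.exp (-(a - (μ * v x - μ ^ 2 * θ * v x / 2))) =
        Real.exp (-a) * Real.exp (-(μ ^ 2 * θ * v x / 2)) * Real.exp (μ * v x) := by
      rw [← Real.exp_add, ← Real.exp_add]
      ring_nf
    rw [e1, e2, Finset.card_insert_of_notMem hx]
    calc _ = 2 ^ (s.card + 1) * Real.exp (-a) *
          (Real.exp (-(μ ^ 2 * θ * v x / 2)) * Real.cosh (μ * v x)) := by
          rw [Real.cosh_eq]
          ring
      _ ≤ 2 ^ (s.card + 1) * Real.exp (-a) *
          (Real.exp (-(μ ^ 2 * θ * v x / 2)) * Real.exp (μ ^ 2 * θ * v x / 2)) := by gcongr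
      _ = _ := by rw [← Real.exp_add, neg_add_cancel, Real.exp_zero, mul_one]

-- The two signs of the deviation are handled by `μ = 2 * d / θ` and its negative, each failing with
-- probability at most `β / 2`. With this `μ` the compensator becomes exactly `d` times the prefix
-- sum.
open Classical in
theorem card_not_balanced_le (γ v : Fin n → ℝ) {θ d β : ℝ} (hv : ∀ i, 0 ≤ v i)
    (hvθ : ∀ i, v i ≤ θ) (hθ : 0 ≤ θ) (hd : 0 < d) (hβ : 0 < β) :
    ((Finset.univ.filter fun W : Finset (Fin n) =>
      ¬ ∀ p, |∑ i with γ i ≤ p, (if i ∈ W then v i else -v i)| ≤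
        d * ∑ i with γ i ≤ p, v i + Real.log (2 / β) / (2 * d) * θ).card : ℝ) ≤ β * 2 ^ n := by
  rcases hθ.eq_or_lt with rfl | hθ
  · have h0 : ∀ i, v i = 0 := fun i => le_antisymm (hvθ i) (hv i)
    simp only [h0]
    simp
    positivity
  have key : ∀ μ, _ := fun μ => card_exists_prefix_ge_le γ v μ hv hvθ Finset.univ (Real.log (2 / β))
  have hexp : Real.exp (-Real.log (2 / β)) = β / 2 := by
    rw [Real.exp_neg, Real.exp_log (by positivity), inv_div]
  have h1 := key (2 * d / θ)
  have h2 := key (-(2 * d / θ))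
  rw [hexp, Finset.powerset_univ, Finset.card_univ, Fintype.card_fin] at h1 h2
  rw [Finset.card_eq_sum_ones, Finset.sum_filter]
  push_cast
  refine (Finset.sum_le_sum fun W _ => ?_).trans
    ((Finset.sum_add_distrib.le.trans (add_le_add h1 h2)).trans (le_of_eq (by ring)))
  have hnn : ∀ P : Prop, (0 : ℝ) ≤ if P then (1 : ℝ) else 0 := fun P => by
    split_ifs <;> norm_num
  split_ifs with h3 <;> try norm_num
  rename_i h4 h5
  refine h3 fun p => ?_
  have hsum : ∀ μ, ∑ i with γ i ≤ p,
      (μ * (if i ∈ W then v i else -v i) - μ ^ 2 * θ * v i / 2) =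
      μ * ∑ i with γ i ≤ p, (if i ∈ W then v i else -v i) -
        μ ^ 2 * θ / 2 * ∑ i with γ i ≤ p, v i := fun μ => by
    rw [Finset.mul_sum, Finset.mul_sum, ← Finset.sum_sub_distrib]
    exact Finset.sum_congr rfl fun i _ => by ring
  have h6 := not_le.1 (not_exists.1 h4 p)
  have h7 := not_le.1 (not_exists.1 h5 p)
  rw [hsum] at h6 h7
  generalize ∑ i with γ i ≤ p, (if i ∈ W then v i else -v i) = D at *
  generalize ∑ i with γ i ≤ p, v i = R at *
  have e : ∀ D, 2 * d / θ * D - (2 * d / θ) ^ 2 * θ / 2 * R = 2 * d / θ * (D - d * R) := by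
    intro D
    field_simp
  have hpos : 0 < 2 * d / θ := by positivity
  have hfin : ∀ D, 2 * d / θ * (D - d * R) < Real.log (2 / β) →
      D ≤ d * R + Real.log (2 / β) / (2 * d) * θ := by
    intro D hD
    have h8 : Real.log (2 / β) = 2 * d / θ * (Real.log (2 / β) / (2 * d) * θ) := by
      field_simp
    rw [h8] at hD
    linarith [lt_of_mul_lt_mul_left hD hpos.le]
  rw [e] at h6
  rw [neg_sq, neg_mul_comm, e] at h7
  exact abs_le'.2 ⟨hfin D h6, hfin (-D) h7⟩

end Concentration

/-! ### Balanced splits of the sellers outside the top set. -/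

section Balanced

variable {u γ : Fin n → ℝ} {X Y T W : Finset (Fin n)} {d e : ℝ}

/-- The posted utilities of `X` and `Y` agree up to a relative error `d` and an absolute error
`e`. -/
def Balanced (u γ : Fin n → ℝ) (d e : ℝ) (X Y : Finset (Fin n)) : Prop :=
  ∀ p, |postedUtility u γ X p - postedUtility u γ Y p| ≤
    d * (postedUtility u γ X p + postedUtility u γ Y p) + e

theorem Balanced.symm (h : Balanced u γ d e X Y) : Balanced u γ d e Y X := fun p => by
  rw [abs_sub_comm, add_comm (postedUtility u γ Y p)]
  exact h p

-- Giving weight `0` to the top set turns the signed prefix sum into `U_X - U_Y` and the unsigned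
-- one into `U_X + U_Y`.
open Classical in
theorem card_not_balanced_split_le {C : ℕ} {β : ℝ} (hu : ∀ i, 0 ≤ u i) (hC : 0 < C) (hd : 0 < d)
    (hβ : 0 < β) :
    ((Finset.univ.filter fun W : Finset (Fin n) =>
      ¬ Balanced u γ d (Real.log (2 / β) / (2 * d) * ((∑ i ∈ topSellers u C, u i) / C))
        (W \ topSellers u C) (topSellers u C ∪ W)ᶜ).card : ℝ) ≤ β * 2 ^ n := by
  set T := topSellers u C
  have hθ : 0 ≤ (∑ i ∈ T, u i) / C :=
    div_nonneg (Finset.sum_nonneg fun i _ => hu i) (Nat.cast_nonneg C)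
  have h := card_not_balanced_le γ (fun i => if i ∈ T then 0 else u i)
    (θ := (∑ i ∈ T, u i) / C) (d := d) (β := β)
    (fun i => by
      split_ifs
      · exact le_rfl
      · exact hu i)
    (fun i => by
      split_ifs with hi
      · exact hθ
      · exact utility_le_of_notMem_topSellers hu hC hi) hθ hd hβ
  refine le_of_eq_of_le ?_ h
  congr 2
  refine Finset.filter_congr fun W _ => not_congr (forall_congr' fun p => ?_)
  have hX : postedUtility u γ (W \ T) p =
      ∑ i, if γ i ≤ p then (if i ∈ T then 0 else if i ∈ W then u i else 0) else 0 := by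
    rw [postedUtility_eq_sum_ite, ← Finset.univ_inter (W \ T), ← Finset.sum_ite_mem]
    refine Finset.sum_congr rfl fun i _ => ?_
    by_cases h1 : i ∈ T <;> by_cases h2 : i ∈ W <;> simp [h1, h2]
  have hY : postedUtility u γ (T ∪ W)ᶜ p =
      ∑ i, if γ i ≤ p then (if i ∈ T then 0 else if i ∈ W then 0 else u i) else 0 := by
    rw [postedUtility_eq_sum_ite, ← Finset.univ_inter (T ∪ W)ᶜ, ← Finset.sum_ite_mem]
    refine Finset.sum_congr rfl fun i _ => ?_
    by_cases h1 : i ∈ T <;> by_cases h2 : i ∈ W <;> simp [h1, h2]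
  rw [hX, hY, ← Finset.sum_sub_distrib, ← Finset.sum_add_distrib, Finset.sum_filter,
    Finset.sum_filter]
  have e1 : ∀ i, ((if γ i ≤ p then (if i ∈ T then 0 else if i ∈ W then u i else 0) else 0) -
      if γ i ≤ p then (if i ∈ T then 0 else if i ∈ W then 0 else u i) else 0) =
      if γ i ≤ p then (if i ∈ W then (if i ∈ T then 0 else u i) else -if i ∈ T then 0 else u i)
        else 0 := by
    intro i
    split_ifs <;> ring
  have e2 : ∀ i, ((if γ i ≤ p then (if i ∈ T then 0 else if i ∈ W then u i else 0) else 0) +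
      if γ i ≤ p then (if i ∈ T then 0 else if i ∈ W then 0 else u i) else 0) =
      if γ i ≤ p then (if i ∈ T then 0 else u i) else 0 := by
    intro i
    split_ifs <;> ring
  simp only [e1, e2]

/-- Once `U_X` reaches `K`, the additive error is at most `d * U_X`. The bounds then follow from `(1
+ 2d) / (1 - d) ≤ 1 + 4d`, which is where `d ≤ 1/4` enters, and `(1 - 2d) / (1 + d) ≥ 1 - 3d`. -/
theorem Balanced.comparison (h : Balanced u γ d e X Y) (hd0 : 0 ≤ d) (hd : d ≤ 1 / 4) {K p : ℝ}
    (hK0 : 0 ≤ K) (heK : e ≤ d * K) (hK : K ≤ postedUtility u γ X p) :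
    postedUtility u γ Y p ≤ (1 + 4 * d) * postedUtility u γ X p ∧
      (1 - 3 * d) * postedUtility u γ X p ≤ postedUtility u γ Y p := by
  obtain ⟨h1, h2⟩ := abs_le.1 (h p)
  have h3 := mul_le_mul_of_nonneg_left hK hd0
  have h4 : 0 ≤ d * postedUtility u γ X p := mul_nonneg hd0 (hK0.trans hK)
  have h5 : 0 ≤ (1 / 4 - d) * (d * postedUtility u γ X p) := mul_nonneg (by linarith) h4
  have h6 : 0 ≤ d * (d * postedUtility u γ X p) := mul_nonneg hd0 h4
  constructor
  · refine le_of_mul_le_mul_left (a := 1 - d) ?_ (by linarith)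
    linarith
  · refine le_of_mul_le_mul_left (a := 1 + d) ?_ (by linarith)
    linarith

end Balanced

/-! ### Utility on a balanced split. -/

section Performance

variable {u γ : Fin n → ℝ} {X Y T W : Finset (Fin n)} {B d e ε₁ δ₁ η : ℝ} {C : ℕ}
  {σ : Equiv.Perm (Fin n)}

theorem sum_applySequentially_eq_value {f : TwoPriceRule} (hf : f.Proper) (hu : ∀ i, 0 ≤ u i)
    (hγ : ∀ i, 0 ≤ γ i) {r : ℝ} (hr : f.cost u γ Y ≤ r) :
    ∑ i ∈ Y, (applySequentially f u γ r (processingOrder σ Y) i).1 * u i = f.value u γ Y := by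
  rw [← sum_alloc_eq_value hf.p₁_le_p₂]
  refine Finset.sum_congr rfl fun i hi => ?_
  rw [applySequentially_of_cost_le hf hu hγ nodup_processingOrder
    (by rwa [toFinset_processingOrder]) (mem_processingOrder.2 hi)]

/-- The rule learned from `X` is almost as good on `Y` as Greedy is on `X`. -/
theorem sum_sampleRule_ge (hu : ∀ i, 0 < u i) (hγ : ∀ i, 0 ≤ γ i) (hB : 0 ≤ B)
    (h : Balanced u γ d e X Y) (hd0 : 0 ≤ d) (hd : d ≤ 1 / 4) (hδ : δ₁ ≤ 1) (hε : ε₁ ≤ 1)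
    (hδε : (1 + 4 * d) * (1 - δ₁) ≤ 1 - ε₁)
    (hK0 : 0 ≤ (∑ i ∈ topSellers u C, u i) / (η * C))
    (heK : e ≤ d * ((∑ i ∈ topSellers u C, u i) / (η * C))) :
    (1 - 3 * d) * (greedy u γ X ((1 - δ₁) * B / 2)).value u γ X -
        (∑ i ∈ topSellers u C, u i) / (η * C) ≤
      ∑ i ∈ Y, (applySequentially (sampleRule u γ B δ₁ η C X) u γ ((1 - ε₁) * B / 2)
        (processingOrder σ Y) i).1 * u i := by
  have hu' : ∀ i, 0 ≤ u i := fun i => (hu i).le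
  have hb : 0 ≤ (1 - δ₁) * B / 2 := by
    have := mul_nonneg (sub_nonneg.2 hδ) hB
    linarith
  have hr : 0 ≤ (1 - ε₁) * B / 2 := by
    have := mul_nonneg (sub_nonneg.2 hε) hB
    linarith
  have hbr : (1 + 4 * d) * ((1 - δ₁) * B / 2) ≤ (1 - ε₁) * B / 2 := by
    have := mul_le_mul_of_nonneg_right hδε hB
    linarith
  have hproper := sampleRule_proper (γ := γ) (η := η) (C := C) (S := X) hu hB hδ
  have hnonneg : 0 ≤ ∑ i ∈ Y, (applySequentially (sampleRule u γ B δ₁ η C X) u γ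
      ((1 - ε₁) * B / 2) (processingOrder σ Y) i).1 * u i := by
    refine Finset.sum_nonneg fun i _ => mul_nonneg ?_ (hu' i)
    have := (isPostedPrice_applySequentially (l := processingOrder σ Y) hproper hu' hγ hr
      i).alloc_nonneg (hγ i)
    rwa [Function.update_eq_self] at this
  have hval := fun hc => sum_applySequentially_eq_value (σ := σ) (Y := Y)
    (r := (1 - ε₁) * B / 2) hproper hu' hγ hc
  have hf := isSupportedRule_greedy (γ := γ) (S := X) hu hb
  set K := (∑ i ∈ topSellers u C, u i) / (η * C) with hK
  have hrule : sampleRule u γ B δ₁ η C X =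
      if postedUtility u γ X (greedy u γ X ((1 - δ₁) * B / 2)).p₁ < K then
        ⟨(greedy u γ X ((1 - δ₁) * B / 2)).t, -1, (greedy u γ X ((1 - δ₁) * B / 2)).p₂⟩
      else greedy u γ X ((1 - δ₁) * B / 2) := rfl
  generalize sampleRule u γ B δ₁ η C X = g at *
  generalize greedy u γ X ((1 - δ₁) * B / 2) = f at *
  have hcost := hf.cost_le
  have ht0 := hf.t_nonneg
  have ht1 : 0 ≤ 1 - f.t := sub_nonneg.2 hf.t_lt_one.le
  have hp1 := hf.p₁_nonneg
  have hp2 := hf.p₁_nonneg.trans hf.p₁_le_p₂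
  have hmono := postedUtility_mono (γ := γ) (S := X) hu' hf.p₁_le_p₂
  have hU1 := postedUtility_nonneg (γ := γ) (S := X) (p := f.p₁) hu'
  rw [TwoPriceRule.cost] at hcost
  rw [TwoPriceRule.value]
  have hcomp := fun p => h.comparison hd0 hd (p := p) hK0 heK
  -- Steps with sampled utility at least `K` transfer from `X` to `Y`, at cost within the budget of
  -- `Y`. Truncating the first step loses at most `(1 - t) * K`.
  by_cases htr : postedUtility u γ X f.p₁ < K
  · rw [if_pos htr] at hrule
    rcases le_or_gt K (postedUtility u γ X f.p₂) with hK2 | hK2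
    · obtain ⟨hle, hge⟩ := hcomp _ hK2
      rw [hval]
      · simp only [hrule, TwoPriceRule.value]
        rw [postedUtility_of_neg hγ (by norm_num : (-1 : ℝ) < 0)]
        have h1 := mul_le_mul_of_nonneg_left hge ht0
        have h2 := mul_le_mul_of_nonneg_left htr.le ht1
        have h3 : 0 ≤ f.t * K := mul_nonneg ht0 hK0
        have h4 : 0 ≤ d * ((1 - f.t) * postedUtility u γ X f.p₁) :=
          mul_nonneg hd0 (mul_nonneg ht1 hU1)
        linarith
      · simp only [hrule, TwoPriceRule.cost]
        rw [postedUtility_of_neg hγ (by norm_num : (-1 : ℝ) < 0)]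
        have h1 := mul_le_mul_of_nonneg_left hle (mul_nonneg ht0 hp2)
        have h2 : 0 ≤ (1 - f.t) * (f.p₁ * postedUtility u γ X f.p₁) :=
          mul_nonneg ht1 (mul_nonneg hp1 hU1)
        have h3 := mul_le_mul_of_nonneg_left hcost (by linarith : 0 ≤ 1 + 4 * d)
        have h4 := mul_nonneg hd0 h2
        linarith
    -- Here neither step is reliable, but the value on `X` is below `K`, so the claimed bound is not
    -- positive.
    · refine le_trans ?_ hnonneg
      have h1 := mul_le_mul_of_nonneg_left hK2.le ht0
      have h2 := mul_le_mul_of_nonneg_left htr.le ht1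
      have h3 : 0 ≤ d * (f.t * postedUtility u γ X f.p₂ + (1 - f.t) * postedUtility u γ X f.p₁) :=
        mul_nonneg hd0 (add_nonneg (mul_nonneg ht0 (hU1.trans hmono)) (mul_nonneg ht1 hU1))
      linarith
  · rw [if_neg htr] at hrule
    rw [not_lt] at htr
    obtain ⟨hle1, hge1⟩ := hcomp _ htr
    obtain ⟨hle2, hge2⟩ := hcomp _ (htr.trans hmono)
    rw [hval]
    · simp only [hrule, TwoPriceRule.value]
      have h1 := mul_le_mul_of_nonneg_left hge1 ht1
      have h2 := mul_le_mul_of_nonneg_left hge2 ht0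
      linarith
    · simp only [hrule, TwoPriceRule.cost]
      have h1 := mul_le_mul_of_nonneg_left hle1 (mul_nonneg ht1 hp1)
      have h2 := mul_le_mul_of_nonneg_left hle2 (mul_nonneg ht0 hp2)
      have h3 := mul_le_mul_of_nonneg_left hcost (by linarith : 0 ≤ 1 + 4 * d)
      linarith

/-- Greedy on one half of a balanced split obtains almost half of the value outside `T` of every
rule that is within budget on all sellers. -/
theorem greedy_value_half_ge (hu : ∀ i, 0 < u i) (hB : 0 ≤ B)
    (hall : ∀ p, postedUtility u γ Finset.univ p =
      postedUtility u γ T p + postedUtility u γ X p + postedUtility u γ Y p)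
    (h : Balanced u γ d e X Y) (hd0 : 0 < d) (hd : d ≤ 1 / 4) (he : 0 ≤ e) (hδ0 : 0 ≤ δ₁)
    (hδ : δ₁ ≤ 1) {f : TwoPriceRule} (hf : IsSupportedRule u γ Finset.univ B f) :
    (1 - δ₁) * (1 - 2 * d) * ((1 - d) / 2 * (f.value u γ X + f.value u γ Y)) - e / d ≤
      (greedy u γ X ((1 - δ₁) * B / 2)).value u γ X := by
  have hu' : ∀ i, 0 ≤ u i := fun i => (hu i).le
  have hb : 0 ≤ (1 - δ₁) * B / 2 := by
    have := mul_nonneg (sub_nonneg.2 hδ) hB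
    linarith
  have hG := isSupportedRule_greedy (γ := γ) (S := X) hu hb
  have hE : 0 ≤ e / d := div_nonneg he hd0.le
  have heE : e = d * (e / d) := (mul_div_cancel₀ _ hd0.ne').symm
  -- Each threshold is either kept (`z = 1`) or dropped (`z = 0`). It is kept when its total utility
  -- is at least `e / d`, so that the error `e` is relative; dropping it loses little.
  have key : ∀ q, ∃ z, 0 ≤ z ∧ z ≤ 1 ∧
      z * postedUtility u γ X q ≤ (1 + 2 * d) / 2 * postedUtility u γ Finset.univ q ∧
      (1 - d) / 2 * (postedUtility u γ X q + postedUtility u γ Y q) - e / d ≤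
        z * postedUtility u γ X q := by
    intro q
    have hT := postedUtility_nonneg (γ := γ) (S := T) (p := q) hu'
    have hX := postedUtility_nonneg (γ := γ) (S := X) (p := q) hu'
    have hY := postedUtility_nonneg (γ := γ) (S := Y) (p := q) hu'
    have hA := postedUtility_nonneg (γ := γ) (S := Finset.univ) (p := q) hu'
    have hq := hall q
    obtain ⟨h1, h2⟩ := abs_le.1 (h q)
    have hdT := mul_nonneg hd0.le hT
    have hdXY := mul_nonneg hd0.le (add_nonneg hX hY)
    have hdE : 0 ≤ (1 / 4 - d) * (e / d) := mul_nonneg (by linarith) hE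
    rcases le_or_gt (e / d) (postedUtility u γ Finset.univ q) with hle | hlt
    · have h3 := mul_le_mul_of_nonneg_left hle hd0.le
      rw [← heE] at h3
      refine ⟨1, zero_le_one, le_rfl, ?_, ?_⟩
      · rw [hq] at h3 ⊢
        linarith
      · linarith
    · refine ⟨0, le_rfl, zero_le_one, ?_, ?_⟩
      · rw [zero_mul]
        exact mul_nonneg (by linarith) hA
      · linarith
  obtain ⟨z₁, hz₁, hz₁', hc₁, hv₁⟩ := key f.p₁
  obtain ⟨z₂, hz₂, hz₂', hc₂, hv₂⟩ := key f.p₂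
  have hcost := hf.cost_le
  have ht0 := hf.t_nonneg
  have ht1 : 0 ≤ 1 - f.t := sub_nonneg.2 hf.t_lt_one.le
  have hp1 := hf.p₁_nonneg
  have hp2 := hf.p₁_nonneg.trans hf.p₁_le_p₂
  rw [TwoPriceRule.cost] at hcost
  -- Weights are scaled by `s = (1 - δ₁) * (1 - 2d)`: the kept thresholds cost up to `(1 + 2d) / 2`
  -- of the original, and `s * (1 + 2d) ≤ 1 - δ₁`.
  have hs0 : 0 ≤ (1 - δ₁) * (1 - 2 * d) := mul_nonneg (by linarith) (by linarith)
  have hs1 : (1 - δ₁) * (1 - 2 * d) ≤ 1 := mul_le_one₀ (by linarith) (by linarith) (by linarith)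
  have hsd : (1 - δ₁) * (1 - 2 * d) * (1 + 2 * d) ≤ 1 - δ₁ := by
    have : 0 ≤ (1 - δ₁) * (4 * (d * d)) :=
      mul_nonneg (by linarith) (by positivity)
    linarith
  set s := (1 - δ₁) * (1 - 2 * d)
  have hw₁ : 0 ≤ s * (1 - f.t) * z₁ := mul_nonneg (mul_nonneg hs0 ht1) hz₁
  have hw₂ : 0 ≤ s * f.t * z₂ := mul_nonneg (mul_nonneg hs0 ht0) hz₂
  have hle₁ : s * (1 - f.t) * z₁ ≤ s * (1 - f.t) :=
    mul_le_of_le_one_right (mul_nonneg hs0 ht1) hz₁'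
  have hle₂ : s * f.t * z₂ ≤ s * f.t := mul_le_of_le_one_right (mul_nonneg hs0 ht0) hz₂'
  have hmix := hG.mixture_le hu' hp1 hp2 hw₁ hw₂ (by linarith) (by
    have h1 := mul_le_mul_of_nonneg_left hc₁ (mul_nonneg (mul_nonneg hs0 ht1) hp1)
    have h2 := mul_le_mul_of_nonneg_left hc₂ (mul_nonneg (mul_nonneg hs0 ht0) hp2)
    have h3 := mul_le_mul_of_nonneg_left hcost (mul_nonneg hs0 (by linarith : 0 ≤ 1 + 2 * d))
    have h4 := mul_le_mul_of_nonneg_right hsd hB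
    linarith)
  refine le_trans ?_ hmix
  have h1 := mul_le_mul_of_nonneg_left hv₁ (mul_nonneg hs0 ht1)
  have h2 := mul_le_mul_of_nonneg_left hv₂ (mul_nonneg hs0 ht0)
  have h3 := mul_le_mul_of_nonneg_right hs1 hE
  simp only [TwoPriceRule.value]
  linarith

/-- On a balanced split, Random-Sampling-Greedy is almost as good as Greedy. -/
theorem utility_run_ge (hu : ∀ i, 0 < u i) (hγ : ∀ i, 0 ≤ γ i) (hB : 0 ≤ B) (hC : 0 < C)
    (hη : 0 < η) (hd0 : 0 < d) (hd : d ≤ 1 / 20) {Λ ε' : ℝ} (hΛ : 0 ≤ Λ) (hΛη : Λ * η ≤ d)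
    (hε : 11 * d ≤ ε') (hε' : ε' ≤ 1)
    (hCε : 2 * Λ / d + 2 / η ≤ ε' * C)
    (h : Balanced u γ d (Λ * ((∑ i ∈ topSellers u C, u i) / C)) (W \ topSellers u C)
      (topSellers u C ∪ W)ᶜ) :
    (1 - ε') * greedyUtility u γ B ≤
      ((randomSamplingGreedy u B d (5 * d) η C σ).run W).utility u γ := by
  have hu' : ∀ i, 0 ≤ u i := fun i => (hu i).le
  have hC' : (0 : ℝ) < C := by exact_mod_cast hC
  have hsplit := sum_eq_top_add_left_add_right (topSellers u C) W
  change _ ≤ ∑ i, (rsgOutcome u B d (5 * d) η C σ W γ i).1 * u i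
  rw [hsplit, greedyUtility_eq hu hB]
  have hT : ∑ i ∈ topSellers u C, (rsgOutcome u B d (5 * d) η C σ W γ i).1 * u i =
      ∑ i ∈ topSellers u C, u i :=
    Finset.sum_congr rfl fun i hi => by rw [rsgOutcome_of_mem_top hi, one_mul]
  have hall : ∀ p, postedUtility u γ Finset.univ p = postedUtility u γ (topSellers u C) p +
      postedUtility u γ (W \ topSellers u C) p + postedUtility u γ (topSellers u C ∪ W)ᶜ p := by
    intro p
    simp only [postedUtility_eq_sum_ite]
    exact hsplit _
  have hall' : ∀ p, postedUtility u γ Finset.univ p = postedUtility u γ (topSellers u C) p +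
      postedUtility u γ (topSellers u C ∪ W)ᶜ p + postedUtility u γ (W \ topSellers u C) p :=
    fun p => by rw [hall]; ring
  have hA0 : 0 ≤ ∑ i ∈ topSellers u C, u i := Finset.sum_nonneg fun i _ => hu' i
  have hK0 : 0 ≤ (∑ i ∈ topSellers u C, u i) / (η * C) :=
    div_nonneg hA0 (mul_pos hη hC').le
  have he0 : 0 ≤ Λ * ((∑ i ∈ topSellers u C, u i) / C) :=
    mul_nonneg hΛ (div_nonneg hA0 hC'.le)
  have heK : Λ * ((∑ i ∈ topSellers u C, u i) / C) ≤
      d * ((∑ i ∈ topSellers u C, u i) / (η * C)) := by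
    have := mul_le_mul_of_nonneg_right hΛη hK0
    refine le_trans (le_of_eq ?_) this
    field_simp
  -- The reserve `δ₁ = 5d` pays for the sampling error `4d` and for the share `ε₁ = d` spent on the
  -- top set.
  have hδε : (1 + 4 * d) * (1 - 5 * d) ≤ 1 - d := by nlinarith
  have hX := sum_sampleRule_ge (σ := σ) hu hγ hB h hd0.le (by linarith) (by linarith) (by linarith)
    hδε hK0 heK
  have hY := sum_sampleRule_ge (σ := σ) hu hγ hB h.symm hd0.le (by linarith) (by linarith)
    (by linarith) hδε hK0 heK
  have eX : ∑ i ∈ W \ topSellers u C, (rsgOutcome u B d (5 * d) η C σ W γ i).1 * u i = _ :=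
    Finset.sum_congr rfl fun i hi => by rw [rsgOutcome_of_mem_left hi]
  have eY : ∑ i ∈ (topSellers u C ∪ W)ᶜ, (rsgOutcome u B d (5 * d) η C σ W γ i).1 * u i = _ :=
    Finset.sum_congr rfl fun i hi => by rw [rsgOutcome_of_mem_right hi]
  have hf := isSupportedRule_greedy (γ := γ) (S := Finset.univ) hu hB
  have gX := greedy_value_half_ge hu hB hall h hd0 (by linarith) he0 (by linarith)
    (by linarith : 5 * d ≤ 1) hf
  have gY := greedy_value_half_ge hu hB hall' h.symm hd0 (by linarith) he0 (by linarith)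
    (by linarith : 5 * d ≤ 1) hf
  have hvT : (greedy u γ Finset.univ B).value u γ Finset.univ ≤ ∑ i ∈ topSellers u C, u i +
      ((greedy u γ Finset.univ B).value u γ (W \ topSellers u C) +
        (greedy u γ Finset.univ B).value u γ (topSellers u C ∪ W)ᶜ) := by
    have hle : ∀ p, postedUtility u γ (topSellers u C) p ≤ ∑ i ∈ topSellers u C, u i := fun p =>
      Finset.sum_le_sum_of_subset_of_nonneg (Finset.filter_subset _ _) fun i _ _ => hu' i
    have h1 := mul_le_mul_of_nonneg_left (hle (greedy u γ Finset.univ B).p₂) hf.t_nonneg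
    have h2 := mul_le_mul_of_nonneg_left (hle (greedy u γ Finset.univ B).p₁)
      (sub_nonneg.2 hf.t_lt_one.le)
    simp only [TwoPriceRule.value, hall]
    linarith
  have hvnn : ∀ S, 0 ≤ (greedy u γ Finset.univ B).value u γ S := fun S =>
    add_nonneg (mul_nonneg hf.t_nonneg (postedUtility_nonneg hu'))
      (mul_nonneg (sub_nonneg.2 hf.t_lt_one.le) (postedUtility_nonneg hu'))
  have hV := hvnn Finset.univ
  have hR := add_nonneg (hvnn (W \ topSellers u C)) (hvnn (topSellers u C ∪ W)ᶜ)
  -- The additive losses of both halves are charged to the top set, which is bought in full.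
  have hloss : 2 * (Λ * ((∑ i ∈ topSellers u C, u i) / C) / d) +
      2 * ((∑ i ∈ topSellers u C, u i) / (η * C)) ≤ ε' * ∑ i ∈ topSellers u C, u i := by
    have := mul_le_mul_of_nonneg_right hCε (div_nonneg hA0 hC'.le)
    refine le_trans (le_of_eq ?_) (this.trans (le_of_eq ?_))
    · field_simp
    · field_simp
  rw [add_comm ((greedy u γ Finset.univ B).value u γ (topSellers u C ∪ W)ᶜ)] at gY
  set R := (greedy u γ Finset.univ B).value u γ (W \ topSellers u C) +
    (greedy u γ Finset.univ B).value u γ (topSellers u C ∪ W)ᶜ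
  have hE0 := div_nonneg he0 hd0.le
  have hcoef : 1 - ε' ≤ (1 - 3 * d) * ((1 - 5 * d) * (1 - 2 * d) * (1 - d)) := by
    have h1 : 1 - 8 * d ≤ (1 - 5 * d) * (1 - 2 * d) * (1 - d) := by
      have : 0 ≤ d * d * (17 - 10 * d) := mul_nonneg (mul_self_nonneg d) (by linarith)
      linarith
    have h2 := mul_le_mul_of_nonneg_left h1 (by linarith : 0 ≤ 1 - 3 * d)
    have h3 := mul_self_nonneg d
    linarith
  have h1 := mul_le_mul_of_nonneg_right hcoef hR
  have h2 := mul_le_mul_of_nonneg_left hvT (sub_nonneg.2 hε')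
  have h3 := mul_le_mul_of_nonneg_left (add_le_add gX gY) (by linarith : 0 ≤ 1 - 3 * d)
  have h4 := mul_nonneg hd0.le hE0
  rw [hT, eX, eY]
  linarith

end Performance

/-! ### From counting splits to probabilities and expectations. -/

section Probability

variable {u γ : Fin n → ℝ} {B ε₁ δ₁ η : ℝ} {C : ℕ} {σ : Equiv.Perm (Fin n)}

open Classical in
theorem le_card_filter_of_card_not_le {α : Type*} [Fintype α] {P : α → Prop} {β N : ℝ}
    (hN : (Fintype.card α : ℝ) = N) (h : ((Finset.univ.filter fun a => ¬ P a).card : ℝ) ≤ β * N) :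
    (1 - β) * N ≤ (Finset.univ.filter P).card := by
  have h1 : ((Finset.univ.filter P).card : ℝ) + (Finset.univ.filter fun a => ¬ P a).card = N := by
    rw [← hN]
    exact_mod_cast Finset.card_filter_add_card_filter_not P
  linarith

open Classical in
theorem prob_randomSamplingGreedy (P : Mechanism n → Prop) :
    (randomSamplingGreedy u B ε₁ δ₁ η C σ).prob P =
      (Finset.univ.filter fun W : Finset (Fin n) =>
        P ((randomSamplingGreedy u B ε₁ δ₁ η C σ).run W)).card / 2 ^ n := by
  have h := PMF.toOuterMeasure_uniformOfFintype_apply (α := Finset (Fin n))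
    {W | P ((randomSamplingGreedy u B ε₁ δ₁ η C σ).run W)}
  have h2 : (randomSamplingGreedy u B ε₁ δ₁ η C σ).prob P =
      ((PMF.uniformOfFintype (Finset (Fin n))).toOuterMeasure
        {W | P ((randomSamplingGreedy u B ε₁ δ₁ η C σ).run W)}).toReal := rfl
  rw [h2, h, ENNReal.toReal_div, ENNReal.toReal_natCast, ENNReal.toReal_natCast,
    Fintype.card_finset, Fintype.card_fin, Nat.cast_pow, Nat.cast_ofNat]
  congr 2
  rw [Fintype.card_subtype]
  rfl

theorem expected_utility_randomSamplingGreedy :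
    (randomSamplingGreedy u B ε₁ δ₁ η C σ).expected.utility u γ =
      (∑ W : Finset (Fin n), ((randomSamplingGreedy u B ε₁ δ₁ η C σ).run W).utility u γ) /
        2 ^ n := by
  have h : ∀ W : Finset (Fin n),
      ((randomSamplingGreedy u B ε₁ δ₁ η C σ).law W).toReal = (2 ^ n)⁻¹ := fun W => by
    change ((PMF.uniformOfFintype (Finset (Fin n))) W).toReal = _
    rw [PMF.uniformOfFintype_apply, ENNReal.toReal_inv, ENNReal.toReal_natCast,
      Fintype.card_finset, Fintype.card_fin, Nat.cast_pow, Nat.cast_ofNat]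
  have h2 : (randomSamplingGreedy u B ε₁ δ₁ η C σ).expected.utility u γ =
      ∑ i, (∑ W : Finset (Fin n), ((randomSamplingGreedy u B ε₁ δ₁ η C σ).law W).toReal *
        ((randomSamplingGreedy u B ε₁ δ₁ η C σ).run W).alloc γ i) * u i := rfl
  rw [h2, div_eq_inv_mul, Finset.mul_sum]
  simp only [h, Mechanism.utility, Finset.sum_mul, Finset.mul_sum]
  rw [Finset.sum_comm]
  exact Finset.sum_congr rfl fun W _ => Finset.sum_congr rfl fun i _ => mul_assoc _ _ _

end Probability

end BudgetFeasible

open BudgetFeasible in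
theorem mainTheorem1 (ε β κ : ℝ) (hε : 0 < ε) (hβ : 0 < β) (hκ : 0 < κ) :
    ∃ (ε₁ δ₁ η ρ : ℝ) (C : ℕ),
      0 < ε₁ ∧ ε₁ < κ ∧ 0 < δ₁ ∧ δ₁ < κ ∧ 0 < η ∧ η < κ ∧ 1 / κ < (C : ℝ) ∧ 0 < ρ ∧
      ∀ (n : ℕ) (u : Fin n → ℝ) (B : ℝ) (σ : Equiv.Perm (Fin n)),
        (∀ i, 0 < u i) → 0 ≤ B →
        (∀ W, ((randomSamplingGreedy u B ε₁ δ₁ η C σ).run W).Valid) ∧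
        (randomSamplingGreedy u B ε₁ δ₁ η C σ).TruthfulInExpectation u ∧
        (randomSamplingGreedy u B ε₁ δ₁ η C σ).StrictlyBudgetFeasible u B ∧
        ∀ c γ : Fin n → ℝ, (∀ i, 0 ≤ c i ∧ c i ≤ ρ * B) → (∀ i, γ i = c i / u i) →
          (∀ W, ((randomSamplingGreedy u B ε₁ δ₁ η C σ).run W).IndividuallyRationalAt u γ) ∧
          1 - β ≤ (randomSamplingGreedy u B ε₁ δ₁ η C σ).prob
            (fun M => (1 - ε) * greedyUtility u γ B ≤ M.utility u γ) ∧
          ∀ M : Mechanism n, M.Valid → M.Truthful u →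
            (∀ γ' : Fin n → ℝ, (∀ i, 0 ≤ γ' i) → M.IndividuallyRationalAt u γ') →
            M.Uniform → M.BudgetFeasibleAt u B γ →
            M.utility u γ ≤ greedyUtility u γ B ∧
            (1 - ε) * M.utility u γ ≤
              (randomSamplingGreedy u B ε₁ δ₁ η C σ).expected.utility u γ := by
  classical
  -- The expectation bound loses twice, on bad splits and on good ones: `(1 - β') * (1 - ε') ≥ 1 -
  -- 2ε' ≥ 1 - ε`.
  obtain ⟨ε', hε'0, hε'1, hε'ε⟩ : ∃ ε' : ℝ, 0 < ε' ∧ ε' ≤ 1 / 2 ∧ 2 * ε' ≤ ε :=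
    ⟨min ε 1 / 2, by positivity, by linarith [min_le_right ε 1], by linarith [min_le_left ε 1]⟩
  obtain ⟨β', hβ'0, hβ'β, hβ'ε⟩ : ∃ β' : ℝ, 0 < β' ∧ β' ≤ β ∧ β' ≤ ε' :=
    ⟨min β ε', lt_min hβ hε'0, min_le_left _ _, min_le_right _ _⟩
  obtain ⟨d, hd0, hdε, hdκ⟩ : ∃ d : ℝ, 0 < d ∧ 20 * d ≤ ε' ∧ 20 * d ≤ κ :=
    ⟨min ε' κ / 20, by positivity, by linarith [min_le_left ε' κ],
      by linarith [min_le_right ε' κ]⟩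
  set Λ := Real.log (2 / β') / (2 * d) with hΛdef
  have hΛ : 0 < Λ := by
    refine div_pos (Real.log_pos ?_) (by positivity)
    rw [lt_div_iff₀ hβ'0]
    linarith
  -- The bound `Λ * η ≤ d` puts the additive sampling error `Λ * U(T) / C` below `d` times the
  -- truncation threshold `U(T) / (η * C)`.
  obtain ⟨η, hη0, hηκ, hΛη⟩ : ∃ η : ℝ, 0 < η ∧ η < κ ∧ Λ * η ≤ d := by
    have hpos : 0 < min (κ / 2) (d / Λ) := by positivity
    refine ⟨min (κ / 2) (d / Λ), hpos, ?_, ?_⟩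
    · linarith [min_le_left (κ / 2) (d / Λ)]
    · have := mul_le_mul_of_nonneg_left (min_le_right (κ / 2) (d / Λ)) hΛ.le
      rwa [mul_div_cancel₀ _ hΛ.ne'] at this
  obtain ⟨C, hC⟩ := exists_nat_gt (max (1 / κ) ((2 * Λ / d + 2 / η) / ε'))
  obtain ⟨hC1, hC2⟩ := max_lt_iff.1 hC
  have hC0 : (0 : ℝ) < C := (by positivity : 0 < 1 / κ).trans hC1
  have hCpos : 0 < C := by exact_mod_cast hC0
  have hCε : 2 * Λ / d + 2 / η ≤ ε' * C := by
    rw [div_lt_iff₀ hε'0] at hC2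
    linarith
  -- With `ρ = ε₁ / C` the fixed payment to a top seller covers any admissible cost.
  refine ⟨d, 5 * d, η, d / C, C, hd0, by linarith, by linarith, by linarith, hη0, hηκ, hC1,
    by positivity, fun n u B σ hu hB => ?_⟩
  have hu' : ∀ i, 0 ≤ u i := fun i => (hu i).le
  have hvalid := valid_randomSamplingGreedy (η := η) (C := C) (σ := σ) (ε₁ := d) (δ₁ := 5 * d)
    hu hB hd0.le (by linarith) (by linarith)
  refine ⟨hvalid, RandomizedMechanism.truthfulInExpectation_of_run
    (truthful_randomSamplingGreedy_run hu hB (by linarith) (by linarith)),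
    strictlyBudgetFeasible_randomSamplingGreedy hu hB hd0.le (by linarith) (by linarith) hCpos,
    fun c γ hc hγc => ?_⟩
  have hγ : ∀ i, 0 ≤ γ i := fun i => by
    rw [hγc]
    exact div_nonneg (hc i).1 (hu' i)
  have hG0 : 0 ≤ greedyUtility u γ B := by
    have hf := isSupportedRule_greedy (γ := γ) (S := Finset.univ) hu hB
    rw [greedyUtility_eq hu hB]
    exact add_nonneg (mul_nonneg hf.t_nonneg (postedUtility_nonneg hu'))
      (mul_nonneg (sub_nonneg.2 hf.t_lt_one.le) (postedUtility_nonneg hu'))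
  have hcard : (Fintype.card (Finset (Fin n)) : ℝ) = 2 ^ n := by simp
  have hgood := le_card_filter_of_card_not_le hcard
    (card_not_balanced_split_le (γ := γ) (C := C) hu' hCpos hd0 hβ'0)
  have hrun : ∀ W, Balanced u γ d (Λ * ((∑ i ∈ topSellers u C, u i) / C)) (W \ topSellers u C)
      (topSellers u C ∪ W)ᶜ → (1 - ε') * greedyUtility u γ B ≤
        ((randomSamplingGreedy u B d (5 * d) η C σ).run W).utility u γ := fun W hW =>
    utility_run_ge hu hγ hB hCpos hη0 hd0 (by linarith) hΛ.le hΛη (by linarith) (by linarith)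
      hCε hW
  have hpow : (0 : ℝ) < 2 ^ n := by positivity
  refine ⟨individuallyRationalAt_randomSamplingGreedy hu hB (by linarith) (by linarith) hγ
    fun i => ?_, ?_, fun M hM ht hir hunif hbud => ?_⟩
  · rw [hγc, div_mul_cancel₀ _ (hu i).ne', mul_div_right_comm]
    exact (hc i).2
  · rw [prob_randomSamplingGreedy, le_div_iff₀ hpow]
    have h1 := mul_le_mul_of_nonneg_right (by linarith : 1 - β ≤ 1 - β') hpow.le
    refine h1.trans (hgood.trans ?_)
    refine Nat.cast_le.2 (Finset.card_le_card fun W hW => ?_)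
    rw [Finset.mem_filter] at hW ⊢
    refine ⟨hW.1, le_trans ?_ (hrun W hW.2)⟩
    exact mul_le_mul_of_nonneg_right (by linarith) hG0
  · have hopt := Mechanism.utility_le_greedyUtility hu hB hγ hM ht hir hunif hbud
    refine ⟨hopt, ?_⟩
    have hM0 : 0 ≤ M.utility u γ :=
      Finset.sum_nonneg fun i _ => mul_nonneg (hM γ hγ i).1 (hu' i)
    rw [expected_utility_randomSamplingGreedy, le_div_iff₀ hpow]
    have hE0 : 0 ≤ (1 - ε') * greedyUtility u γ B := mul_nonneg (by linarith) hG0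
    have h1 : (1 - β') * 2 ^ n * ((1 - ε') * greedyUtility u γ B) ≤
        ∑ W : Finset (Fin n),
          ((randomSamplingGreedy u B d (5 * d) η C σ).run W).utility u γ := by
      refine (mul_le_mul_of_nonneg_right hgood hE0).trans ?_
      rw [← nsmul_eq_mul]
      refine (Finset.card_nsmul_le_sum _ _ _ fun W hW =>
        hrun W (Finset.mem_filter.1 hW).2).trans ?_
      -- Unbalanced splits are discarded, since their utility is nonnegative.
      exact Finset.sum_le_sum_of_subset_of_nonneg (Finset.filter_subset _ _) fun W _ _ =>
        Finset.sum_nonneg fun i _ => mul_nonneg (hvalid W γ hγ i).1 (hu' i)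
    refine le_trans ?_ h1
    have h2 : (1 - ε) * M.utility u γ ≤ (1 - β') * ((1 - ε') * greedyUtility u γ B) := by
      have h3 : (1 - ε) * M.utility u γ ≤ (1 - 2 * ε') * M.utility u γ :=
        mul_le_mul_of_nonneg_right (by linarith) hM0
      have h4 : (1 - 2 * ε') * M.utility u γ ≤ (1 - 2 * ε') * greedyUtility u γ B :=
        mul_le_mul_of_nonneg_left hopt (by linarith)
      have h5 := mul_nonneg (mul_nonneg hβ'0.le hε'0.le) hG0
      have h6 := mul_le_mul_of_nonneg_right hβ'ε hG0
      linarith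
    linarith [mul_le_mul_of_nonneg_right h2 hpow.le]
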